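/- Let $\alpha,\beta>0$ and $\gamma\in\mathbb{R}$, and for $t<0$ let $w(x;t)=(x-t)^{\gamma}x^{\alpha}(1-x)^{\beta}$, $x\in[0,1]$. Let $P_n(x)=P_n(x;t)$, $n\ge 0$, be the monic polynomials of degree $n$ with $$\int_0^1 P_m(x)P_n(x)\,w(x;t)\,dx=h_n\,\delta_{m,n},\qquad h_n=h_n(t)>0,$$ and let $\alpha_n=\alpha_n(t)$, $\beta_n=\beta_n(t)$ be the coefficients of the three-term recurrence $xP_n=P_{n+1}+\alpha_nP_n+\beta_nP_{n-1}$ (with $P_0=1$, $\beta_0P_{-1}=0$). Put $$R_n(t)=\frac{\beta}{h_n}\int_0^1 P_n(y)^2\,w(y;t)\,\frac{dy}{1-y}.$$ (i) For every $n\ge 1$ and $t<0$, $\beta_n$ is differentiable at $t$ and $$t\,\frac{d}{dt}\beta_n=(2+R_{n-1}-R_n)\,\beta_n .$$ (ii) Let $n\ge 0$ be such that $2n+\alpha+\beta+\gamma+1\neq 0$, and put $$W_n(t)=\frac{(t-1)R_n(t)}{2n+\alpha+\beta+\gamma+1}+1 .$$ If $\gamma\ne 0$, then on $t<0$ the function $W_n$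 is twice differentiable, takes none of the values $0$, $1$, $t$ at any $t$, and satisfies the Painlevé VI equation $$W_n''=\frac12\Bigl(\frac1{W_n}+\frac1{W_n-1}+\frac1{W_n-t}\Bigr)(W_n')^2-\Bigl(\frac1t+\frac1{t-1}+\frac1{W_n-t}\Bigr)W_n'+\frac{W_n(W_n-1)(W_n-t)}{t^2(t-1)^2}\Bigl(\mu_1+\frac{\mu_2t}{W_n^2}+\frac{\mu_3(t-1)}{(W_n-1)^2}+\frac{\mu_4t(t-1)}{(W_n-t)^2}\Bigr)$$ with $\mu_1=\frac{(2n+\alpha+\beta+\gamma+1)^2}{2}$, $\mu_2=-\frac{\alpha^2}{2}$, $\mu_3=\frac{\beta^2}{2}$, $\mu_4=\frac{1-\gamma^2}{2}$. If $\gamma=0$, then $W_n(t)=t$ for all $t<0$, the degenerate case in which the denominator $W_n-t$ vanishes identically. -/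

import Mathlib

open Polynomial

noncomputable section

namespace GenJacobi

/-- The generalized Jacobi weight `w(x; t) = (x - t)^γ x^α (1 - x)^β`, used for `0 ≤ x ≤ 1`, `t < 0`. -/
def weight (α β γ t x : ℝ) : ℝ := (x - t) ^ γ * x ^ α * (1 - x) ^ β

/-- The bilinear form `∫₀¹ p(x) q(x) w(x) dx` on real polynomials. -/
def form (w : ℝ → ℝ) (p q : ℝ[X]) : ℝ := ∫ x in (0 : ℝ)..1, p.eval x * q.eval x * w x

/-- The monic orthogonal polynomials of a weight `w` on `[0, 1]`, built from `1, X, X², …` by the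
Gram-Schmidt process. -/
def monicOP (w : ℝ → ℝ) (n : ℕ) : ℝ[X] :=
  X ^ n - ∑ k : Fin n,
    C (form w (X ^ n) (monicOP w k) / form w (monicOP w k) (monicOP w k)) * monicOP w k
termination_by n
decreasing_by all_goals exact k.isLt

/-- `P` is the sequence of monic orthogonal polynomials of the weight `w` on `[0, 1]`, with positive
squared norms `h`: `P n` is monic of degree `n`, and `∫₀¹ P m P n w = h n δ_{m n}` with `h n > 0`. -/
structure IsMonicOPSystem (w : ℝ → ℝ) (P : ℕ → ℝ[X]) (h : ℕ → ℝ) : Prop where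
  monic : ∀ n, (P n).Monic
  natDegree_eq : ∀ n, (P n).natDegree = n
  integrable : ∀ m n, IntervalIntegrable (fun x => (P m).eval x * (P n).eval x * w x)
    MeasureTheory.volume 0 1
  orthogonal : ∀ m n, ∫ x in (0 : ℝ)..1, (P m).eval x * (P n).eval x * w x = if m = n then h n else 0
  pos : ∀ n, 0 < h n

/-- The three-term recurrence `x P n = P (n+1) + a n P n + b n P (n-1)`, with `P 0 = 1` and the
convention `b 0 P (-1) = 0`. -/
structure ThreeTermRecurrence (P : ℕ → ℝ[X]) (a b : ℕ → ℝ) : Prop where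
  init : P 0 = 1
  zero : X * P 0 = P 1 + C (a 0) * P 0
  succ : ∀ n, X * P (n + 1) = P (n + 2) + C (a (n + 1)) * P (n + 1) + C (b (n + 1)) * P n

section

variable (α β γ : ℝ)

/-- The monic generalized Jacobi polynomial `P_n(x) = P_n(x; t)`. -/
def P (n : ℕ) (t : ℝ) : ℝ[X] := monicOP (weight α β γ t) n

/-- The squared norm `h_n(t) = ∫₀¹ P_n² w dx`. -/
def h (n : ℕ) (t : ℝ) : ℝ := form (weight α β γ t) (P α β γ n t) (P α β γ n t)

/-- The recurrence coefficient `α_n(t)` : the component of `x P_n` along `P_n`. -/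
def recAlpha (n : ℕ) (t : ℝ) : ℝ :=
  form (weight α β γ t) (X * P α β γ n t) (P α β γ n t) / h α β γ n t

/-- The recurrence coefficient `β_n(t)`, `n ≥ 1` : the component of `x P_n` along `P_{n-1}`;
by convention `β_0 = 0`. -/
def recBeta : ℕ → ℝ → ℝ
  | 0, _ => 0
  | n + 1, t => form (weight α β γ t) (X * P α β γ (n + 1) t) (P α β γ n t) / h α β γ n t

/-- The integrand `P_n(y)² w(y; t) / (1 - y)`. -/
def integrandR (n : ℕ) (t y : ℝ) : ℝ :=
  ((P α β γ n t).eval y) ^ 2 * weight α β γ t y / (1 - y)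

/-- `R_n(t) = (β / h_n) ∫₀¹ P_n(y)² w(y; t) dy / (1 - y)`. -/
def R (n : ℕ) (t : ℝ) : ℝ := β / h α β γ n t * ∫ y in (0 : ℝ)..1, integrandR α β γ n t y

/-- `W_n(t) = (t - 1) R_n(t) / (2n + α + β + γ + 1) + 1`. -/
def W (n : ℕ) (t : ℝ) : ℝ := (t - 1) * R α β γ n t / (2 * n + α + β + γ + 1) + 1

end

/-- `y` is a solution on `s` of the sixth Painlevé equation with parameters `μ₁, μ₂, μ₃, μ₄`: on `s`
it is twice differentiable, none of the denominators in the equation vanishes, and the equation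
holds. -/
def SolvesPainleveVI (μ₁ μ₂ μ₃ μ₄ : ℝ) (s : Set ℝ) (y : ℝ → ℝ) : Prop :=
  ∀ t ∈ s, t ≠ 0 ∧ t ≠ 1 ∧ y t ≠ 0 ∧ y t ≠ 1 ∧ y t ≠ t ∧
    DifferentiableAt ℝ y t ∧ DifferentiableAt ℝ (deriv y) t ∧
    deriv (deriv y) t =
      1 / 2 * (1 / y t + 1 / (y t - 1) + 1 / (y t - t)) * (deriv y t) ^ 2
      - (1 / t + 1 / (t - 1) + 1 / (y t - t)) * deriv y t
      + y t * (y t - 1) * (y t - t) / (t ^ 2 * (t - 1) ^ 2) *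
        (μ₁ + μ₂ * t / (y t) ^ 2 + μ₃ * (t - 1) / (y t - 1) ^ 2
          + μ₄ * t * (t - 1) / (y t - t) ^ 2)

end GenJacobi

end

/-!
Write `w = (x - t)^γ x^α (1 - x)^β`, `L f = ∫ f w`, and let `poleZero`, `poleT`, `poleOne` be the
functionals `f ↦ α ∫ f w / x`, `γ ∫ f w / (x - t)`, `β ∫ f w / (1 - x)`. Everything algebraic follows
from two facts: multiplication by `x`, `x - t`, `x - 1` turns these functionals into `α L`, `γ L`,
`-β L`, and integration by parts gives `L f' + poleZero f + poleT f - poleOne f = 0`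
(`weightFun_derivative`). For fixed `n` put

* `A`, `G`, `R` for the values of the three functionals at `P n ^ 2 / h n`,
* `a`, `g`, `r` for their values at `P n P (n - 1) / h (n - 1)`.

Integrating by parts `P n ^ 2` and `x P n ^ 2` gives `A + G = R` and `t G = R - c` with
`c = 2 n + α + β + γ + 1`. Hence `W = t A / c`, `W - 1 = (t - 1) R / c`, `W - t = t (t - 1) G / c`.
As `A, R > 0`, and `G` has the sign of `γ`, the three forbidden values are avoided when `γ ≠ 0`, and
`W = t` when `γ = 0`.

A functional `M` with `M ((X - z) f) = κ L f` satisfies `M (P n f) = f(z) M (P n)` for `f` of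
degree at most `n`; evaluating `M (P n P (n - 1))` in two ways gives
`m (m - κ) = (h n / h (n - 1)) M_n M_{n-1}` for the normalized values (`IsOrthogonalFor.pole_quadratic`). Applied at the three poles, with
`a = r - g - n` from integration by parts, it leaves one algebraic relation among `R`, `G`, `r`, `g`
after the quantities of index `n - 1` are eliminated (`pole_constraint`).

The dependence on `t` comes from `dL/dt = -poleT`. It gives `h_n' = -G h_n`, from which part (i)
follows with `t G = R - c`. The derivative `Q` of `P n` in `t` represents `f ↦ poleT (P n f)` on lower
degrees, so `(x - t) Q` is a combination of `P n` and `P (n - 1)`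
(`IsOrthogonalFor.X_sub_C_mul_deriv_succ`). This closes a system of differential equations for `R`,
`r` and `g` (`hasDerivAt_R`, `hasDerivAt_poleOneOff`, `hasDerivAt_poleTOff`). Differentiating the
first equation once more expresses `W''` through `t`, `R`, `G`, `r`, `g`, and the difference of the
two sides of the Painlevé equation is a multiple of the algebraic relation (`painleveVI_identity`).
-/

noncomputable section

namespace GenJacobi

/-! ### Orthogonal polynomials of a linear functional -/

/-- `p` is the sequence of monic orthogonal polynomials of the linear functional `L`, and the
numbers `h n = L (p n ^ 2)` do not vanish. -/
structure IsOrthogonalFor (L : ℝ[X] →ₗ[ℝ] ℝ) (p : ℕ → ℝ[X]) (h : ℕ → ℝ) : Prop where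
  monic : ∀ n, (p n).Monic
  natDegree_eq : ∀ n, (p n).natDegree = n
  orthogonal : ∀ m n, L (p m * p n) = if m = n then h n else 0
  ne_zero : ∀ n, h n ≠ 0

lemma map_C_mul (L : ℝ[X] →ₗ[ℝ] ℝ) (a : ℝ) (f : ℝ[X]) : L (C a * f) = a * L f := by
  rw [← smul_eq_C_mul, map_smul, smul_eq_mul]

lemma degreeLT_coeff {f : ℝ[X]} {n : ℕ} : f ∈ degreeLT ℝ n ↔ ∀ m, n ≤ m → f.coeff m = 0 := by
  rw [mem_degreeLT, degree_lt_iff_coeff_zero]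

lemma X_sub_C_mul_mem_degreeLT {f : ℝ[X]} {n : ℕ} (hf : f ∈ degreeLT ℝ n) (z : ℝ) :
    (X - C z) * f ∈ degreeLT ℝ (n + 1) := by
  rw [degreeLT_coeff] at *
  intro m hm
  obtain ⟨m, rfl⟩ : ∃ k, m = k + 1 := ⟨m - 1, by omega⟩
  rw [sub_mul, coeff_sub, coeff_X_mul, coeff_C_mul, hf m (by omega), hf (m + 1) (by omega)]
  ring

lemma C_mul_mem_degreeLT {f : ℝ[X]} {n : ℕ} (hf : f ∈ degreeLT ℝ n) (a : ℝ) :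
    C a * f ∈ degreeLT ℝ n := by
  rw [← smul_eq_C_mul]; exact Submodule.smul_mem _ _ hf

/-- A polynomial of degree at most `n` splits as `f(z) + (X - z) q`, and the coefficient of `q` in
degree `n - 1` is that of `f` in degree `n`. -/
lemma exists_eq_C_eval_add {f : ℝ[X]} {n : ℕ} (hf : f ∈ degreeLT ℝ (n + 1)) (z : ℝ) :
    ∃ q ∈ degreeLT ℝ n, f = C (f.eval z) + (X - C z) * q ∧
      ∀ k, n = k + 1 → q.coeff k = f.coeff n := by
  obtain ⟨q, hq⟩ := X_sub_C_dvd_sub_C_eval (a := z) (p := f)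
  have hq' : f = C (f.eval z) + (X - C z) * q := by rw [← hq]; ring
  have hqd : q ∈ degreeLT ℝ n := by
    rw [mem_degreeLT]
    by_cases h0 : q = 0
    · simp [h0]
    have hne : f - C (f.eval z) ≠ 0 := by
      rw [hq]; exact mul_ne_zero (X_sub_C_ne_zero z) h0
    have h1 : (f - C (f.eval z)).degree < ((n + 1 : ℕ) : WithBot ℕ) := by
      rw [← mem_degreeLT]
      refine Submodule.sub_mem _ hf ?_
      rw [mem_degreeLT]
      exact lt_of_le_of_lt degree_C_le (by exact_mod_cast Nat.succ_pos n)
    rw [degree_eq_natDegree hne, hq, (monic_X_sub_C z).natDegree_mul' h0, natDegree_X_sub_C] at h1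
    rw [degree_eq_natDegree h0]
    have : 1 + q.natDegree < n + 1 := by exact_mod_cast h1
    exact_mod_cast (by omega : q.natDegree < n)
  refine ⟨q, hqd, hq', ?_⟩
  rintro k rfl
  have := degreeLT_coeff.1 hqd (k + 1) le_rfl
  rw [hq', coeff_add, sub_mul, coeff_sub, coeff_X_mul, coeff_C_mul, this, coeff_C_succ]
  ring

namespace IsOrthogonalFor

variable {L : ℝ[X] →ₗ[ℝ] ℝ} {p : ℕ → ℝ[X]} {h : ℕ → ℝ}

lemma coeff_self (H : IsOrthogonalFor L p h) (n : ℕ) : (p n).coeff n = 1 := by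
  have := (H.monic n).coeff_natDegree
  rwa [H.natDegree_eq] at this

lemma mem_degreeLT (H : IsOrthogonalFor L p h) {m n : ℕ} (hmn : m < n) : p m ∈ degreeLT ℝ n := by
  rw [degreeLT_coeff]
  intro k hk
  exact coeff_eq_zero_of_natDegree_lt (by rw [H.natDegree_eq]; omega)

lemma sub_mem_degreeLT (H : IsOrthogonalFor L p h) {n : ℕ} {f : ℝ[X]}
    (hf : f ∈ degreeLT ℝ (n + 1)) : f - C (f.coeff n) * p n ∈ degreeLT ℝ n := by
  rw [degreeLT_coeff] at *
  intro k hk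
  rcases hk.eq_or_lt with rfl | hk
  · simp [H.coeff_self]
  · have hpk : (p n).coeff k = 0 :=
      coeff_eq_zero_of_natDegree_lt (by rw [H.natDegree_eq]; omega)
    rw [coeff_sub, hf k hk, coeff_C_mul, hpk]
    ring

lemma mul_self (H : IsOrthogonalFor L p h) (n : ℕ) : L (p n * p n) = h n := by
  rw [H.orthogonal, if_pos rfl]

lemma mul_eq_zero (H : IsOrthogonalFor L p h) {n : ℕ} {f : ℝ[X]} (hf : f ∈ degreeLT ℝ n) :
    L (p n * f) = 0 := by
  suffices ∀ m ≤ n, ∀ f ∈ degreeLT ℝ m, L (p n * f) = 0 from this n le_rfl f hf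
  intro m
  induction m with
  | zero =>
    intro _ f hf
    have : f = 0 := by
      ext k
      simpa using degreeLT_coeff.1 hf k (Nat.zero_le k)
    simp [this]
  | succ m ih =>
    intro hm f hf
    have h1 := ih (by omega) _ (H.sub_mem_degreeLT hf)
    rw [mul_sub, map_sub, mul_left_comm, map_C_mul, H.orthogonal, if_neg (by omega)] at h1
    linarith

lemma mul_eq_coeff (H : IsOrthogonalFor L p h) {n : ℕ} {f : ℝ[X]} (hf : f ∈ degreeLT ℝ (n + 1)) :
    L (p n * f) = f.coeff n * h n := by
  have h1 := H.mul_eq_zero (H.sub_mem_degreeLT hf)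
  rw [mul_sub, map_sub, mul_left_comm, map_C_mul, H.mul_self] at h1
  linarith

lemma eq_zero (H : IsOrthogonalFor L p h) {N : ℕ} {f : ℝ[X]} (hf : f ∈ degreeLT ℝ N)
    (h0 : ∀ k < N, L (p k * f) = 0) : f = 0 := by
  induction N with
  | zero =>
    ext k
    simpa using degreeLT_coeff.1 hf k (Nat.zero_le k)
  | succ N ih =>
    have h1 := h0 N (by omega)
    rw [H.mul_eq_coeff hf] at h1
    have h2 : f.coeff N = 0 := (_root_.mul_eq_zero.1 h1).resolve_right (H.ne_zero N)
    have h3 := H.sub_mem_degreeLT hf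
    rw [h2] at h3
    exact ih (by simpa using h3) fun k hk => h0 k (by omega)

lemma eq_C_mul (H : IsOrthogonalFor L p h) {n : ℕ} {f : ℝ[X]} (hf : f ∈ degreeLT ℝ (n + 1))
    (h0 : ∀ g ∈ degreeLT ℝ n, L (g * f) = 0) : f = C (f.coeff n) * p n := by
  have : f - C (f.coeff n) * p n = 0 := by
    refine H.eq_zero (H.sub_mem_degreeLT hf) fun k hk => ?_
    rw [mul_sub, map_sub, h0 _ (H.mem_degreeLT hk), mul_left_comm, map_C_mul, H.orthogonal,
      if_neg (by omega)]
    ring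
  linear_combination this

lemma three_term (H : IsOrthogonalFor L p h) :
    ThreeTermRecurrence p (fun n => L (X * p n * p n) / h n)
      (fun n => L (X * p n * p (n - 1)) / h (n - 1)) := by
  have hX : ∀ {f : ℝ[X]} {n : ℕ}, f ∈ degreeLT ℝ n → X * f ∈ degreeLT ℝ (n + 1) := by
    intro f n hf
    simpa using X_sub_C_mul_mem_degreeLT hf 0
  have hlead : ∀ n, X * p n - p (n + 1) ∈ degreeLT ℝ (n + 1) := by
    intro n
    have := H.sub_mem_degreeLT (hX (H.mem_degreeLT (Nat.lt_succ_self n)))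
    rwa [coeff_X_mul, H.coeff_self, C_1, one_mul] at this
  refine ⟨?_, ?_, fun n => ?_⟩
  · exact eq_one_of_monic_natDegree_zero (H.monic 0) (H.natDegree_eq 0)
  · have h0 := H.eq_zero (N := 1) (f := X * p 0 - p 1 - C (L (X * p 0 * p 0) / h 0) * p 0)
      (Submodule.sub_mem _ (hlead 0) (C_mul_mem_degreeLT (H.mem_degreeLT (by omega)) _)) ?_
    · linear_combination h0
    intro k hk
    obtain rfl : k = 0 := by omega
    rw [mul_sub, mul_sub, map_sub, map_sub, mul_left_comm (p 0) (C _), map_C_mul, H.orthogonal,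
      H.orthogonal, mul_comm (p 0) (X * p 0)]
    simp [H.ne_zero 0]
  · simp only [Nat.add_sub_cancel]
    have h0 := H.eq_zero (N := n + 2) (f := X * p (n + 1) - p (n + 2)
        - C (L (X * p (n + 1) * p (n + 1)) / h (n + 1)) * p (n + 1)
        - C (L (X * p (n + 1) * p n) / h n) * p n)
      (Submodule.sub_mem _ (Submodule.sub_mem _ (hlead _)
        (C_mul_mem_degreeLT (H.mem_degreeLT (by omega)) _))
        (C_mul_mem_degreeLT (H.mem_degreeLT (by omega)) _)) ?_
    · linear_combination h0
    intro k hk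
    have e : p k * (X * p (n + 1) - p (n + 2)
        - C (L (X * p (n + 1) * p (n + 1)) / h (n + 1)) * p (n + 1)
        - C (L (X * p (n + 1) * p n) / h n) * p n) = X * p (n + 1) * p k - p k * p (n + 2)
        - C (L (X * p (n + 1) * p (n + 1)) / h (n + 1)) * (p k * p (n + 1))
        - C (L (X * p (n + 1) * p n) / h n) * (p k * p n) := by ring
    rw [e]
    simp only [map_sub, map_C_mul, H.orthogonal]
    rw [if_neg (by omega)]
    rcases (by omega : k = n + 1 ∨ k = n ∨ k < n) with rfl | rfl | hk
    · simp [H.ne_zero]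
    · simp [H.ne_zero]
    · rw [if_neg (by omega), if_neg (by omega), mul_comm X, mul_assoc,
        H.mul_eq_zero (degreeLT_coeff.2 fun m hm => ?_)]
      · ring
      · exact degreeLT_coeff.1 (hX (H.mem_degreeLT hk)) m (by omega)

lemma beta_eq (H : IsOrthogonalFor L p h) (n : ℕ) :
    L (X * p (n + 1) * p n) = h (n + 1) := by
  rw [mul_comm X, mul_assoc, H.mul_eq_coeff, coeff_X_mul, H.coeff_self, one_mul]
  simpa using X_sub_C_mul_mem_degreeLT (H.mem_degreeLT (Nat.lt_succ_self n)) 0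

/-! ### Functionals with a simple pole -/

section Pole

variable {M : ℝ[X] →ₗ[ℝ] ℝ} {z κ : ℝ}

/-- If `M` is `κ L` divided by `X - z`, then `M (p n * f)` only sees the value of `f` at `z` and the
coefficient of `f` in degree `n + 1`, for all `f` of degree at most `n + 1`. -/
lemma pole_mul (H : IsOrthogonalFor L p h) (hM : ∀ f, M ((X - C z) * f) = κ * L f) {n : ℕ}
    {f : ℝ[X]} (hf : f ∈ degreeLT ℝ (n + 2)) :
    M (p n * f) = f.eval z * M (p n) + κ * (f.coeff (n + 1) * h n) := by
  obtain ⟨q, hq, e, hc⟩ := exists_eq_C_eval_add hf z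
  have e' : p n * f = C (f.eval z) * p n + (X - C z) * (p n * q) := by
    conv_lhs => rw [e]
    ring
  rw [e', map_add, map_C_mul, hM, H.mul_eq_coeff hq, hc n rfl]

lemma pole_mul_of_le (H : IsOrthogonalFor L p h) (hM : ∀ f, M ((X - C z) * f) = κ * L f) {n : ℕ}
    {f : ℝ[X]} (hf : f ∈ degreeLT ℝ (n + 1)) : M (p n * f) = f.eval z * M (p n) := by
  rw [H.pole_mul hM (degreeLT_coeff.2 fun m hm => degreeLT_coeff.1 hf m (by omega)),
    degreeLT_coeff.1 hf _ le_rfl]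
  ring

lemma pole_self (H : IsOrthogonalFor L p h) (hM : ∀ f, M ((X - C z) * f) = κ * L f) (n : ℕ) :
    M (p n * p n) = (p n).eval z * M (p n) :=
  H.pole_mul_of_le hM (H.mem_degreeLT (Nat.lt_succ_self n))

lemma pole_succ (H : IsOrthogonalFor L p h) (hM : ∀ f, M ((X - C z) * f) = κ * L f) (n : ℕ) :
    M (p (n + 1) * p n) = (p n).eval z * M (p (n + 1)) :=
  H.pole_mul_of_le hM (H.mem_degreeLT (by omega))

lemma pole_succ' (H : IsOrthogonalFor L p h) (hM : ∀ f, M ((X - C z) * f) = κ * L f) (n : ℕ) :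
    M (p (n + 1) * p n) = (p (n + 1)).eval z * M (p n) + κ * h n := by
  rw [mul_comm, H.pole_mul hM (H.mem_degreeLT (by omega)), H.coeff_self, one_mul]

/-- The two ways of evaluating `M (p (n + 1) * p n)` give a quadratic relation between its value and
the values of `M` at two consecutive squares. -/
lemma pole_quadratic (H : IsOrthogonalFor L p h) (hM : ∀ f, M ((X - C z) * f) = κ * L f) (n : ℕ) :
    M (p (n + 1) * p n) * (M (p (n + 1) * p n) - κ * h n) =
      M (p (n + 1) * p (n + 1)) * M (p n * p n) := by
  have h1 := H.pole_succ hM n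
  have h2 := H.pole_succ' hM n
  rw [H.pole_self hM, H.pole_self hM]
  rw [show M (p (n + 1) * p n) - κ * h n = (p (n + 1)).eval z * M (p n) by rw [h2]; ring, h1]
  ring

/-- If `M = -dL/dt` has its pole at `z = t`, then the `t`-derivative `q` of `p (n + 1)` is a
combination of `p (n + 1)` and `p n`, divided by `X - t`. -/
lemma X_sub_C_mul_deriv_succ (H : IsOrthogonalFor L p h)
    (hM : ∀ f, M ((X - C z) * f) = κ * L f) {n : ℕ} (hne : M (p n * p n) ≠ 0) {q : ℝ[X]}
    (hq : q ∈ degreeLT ℝ (n + 1))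
    (hqL : ∀ f ∈ degreeLT ℝ (n + 1), L (q * f) = M (p (n + 1) * f)) :
    (X - C z) * q = C (M (p (n + 1) * p n) / h n) * p (n + 1) -
      C (M (p (n + 1) * p (n + 1)) / h n) * p n := by
  have hz : (p n).eval z ≠ 0 := fun h0 => hne (by rw [H.pole_self hM, h0, zero_mul])
  have hcoeff : q.coeff n = M (p (n + 1) * p n) / h n := by
    rw [eq_div_iff (H.ne_zero n), ← H.mul_eq_coeff hq, mul_comm,
      hqL _ (H.mem_degreeLT (by omega))]
  set f := (X - C z) * q - C (M (p (n + 1) * p n) / h n) * p (n + 1) +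
      C (M (p (n + 1) * p (n + 1)) / h n) * p n with hf
  have hf1 : f ∈ degreeLT ℝ (n + 1) := by
    have h1 := H.sub_mem_degreeLT (X_sub_C_mul_mem_degreeLT hq z)
    rw [sub_mul, coeff_sub, coeff_X_mul, coeff_C_mul, degreeLT_coeff.1 hq (n + 1) le_rfl,
      hcoeff] at h1
    refine Submodule.add_mem _ ?_ (C_mul_mem_degreeLT (H.mem_degreeLT (by omega)) _)
    rw [sub_mul]
    simpa using h1
  have hf2 : f = C (f.coeff n) * p n := by
    refine H.eq_C_mul hf1 fun g hg => ?_
    have e : g * f = q * ((X - C z) * g) - C (M (p (n + 1) * p n) / h n) * (p (n + 1) * g) +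
      C (M (p (n + 1) * p (n + 1)) / h n) * (p n * g) := by rw [hf]; ring
    have hg' : g ∈ degreeLT ℝ (n + 1) :=
      degreeLT_coeff.2 fun m hm => degreeLT_coeff.1 hg m (by omega)
    rw [e, map_add, map_sub, map_C_mul, map_C_mul, H.mul_eq_zero hg, H.mul_eq_zero hg',
      hqL _ (X_sub_C_mul_mem_degreeLT hg z), mul_left_comm, hM, H.mul_eq_zero hg']
    ring
  -- at `X = z` the left-hand side vanishes, and so does the right-hand side
  have hf3 : f.eval z = 0 := by
    rw [hf, H.pole_succ hM, H.pole_self hM]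
    simp
    ring
  rw [hf2, eval_mul, eval_C] at hf3
  rw [(_root_.mul_eq_zero.1 hf3).resolve_right hz] at hf2
  rw [C_0, zero_mul] at hf2
  linear_combination hf2

/-- The companion of `X_sub_C_mul_deriv_succ` for the `t`-derivative `q` of the lower of the two
polynomials. -/
lemma X_sub_C_mul_deriv (H : IsOrthogonalFor L p h)
    (hM : ∀ f, M ((X - C z) * f) = κ * L f) {n : ℕ} (hne : M (p n * p n) ≠ 0) {q : ℝ[X]}
    (hq : q ∈ degreeLT ℝ n)
    (hqL : ∀ f ∈ degreeLT ℝ n, L (q * f) = M (p n * f)) :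
    (X - C z) * q = C (κ - M (p (n + 1) * p n) / h n) * p n -
      C (M (p n * p n) / h n) * ((X - C z) * p n - p (n + 1)) := by
  have hz : (p n).eval z ≠ 0 := fun h0 => hne (by rw [H.pole_self hM, h0, zero_mul])
  have hlead : (X - C z) * p n - p (n + 1) ∈ degreeLT ℝ (n + 1) := by
    have := H.sub_mem_degreeLT (X_sub_C_mul_mem_degreeLT (H.mem_degreeLT (Nat.lt_succ_self n)) z)
    rw [sub_mul, coeff_sub, coeff_X_mul, H.coeff_self, coeff_C_mul,
      degreeLT_coeff.1 (H.mem_degreeLT (Nat.lt_succ_self n)) (n + 1) le_rfl] at this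
    rw [sub_mul]
    simpa using this
  set f := (X - C z) * q - C (κ - M (p (n + 1) * p n) / h n) * p n +
      C (M (p n * p n) / h n) * ((X - C z) * p n - p (n + 1)) with hf
  have hf1 : f ∈ degreeLT ℝ (n + 1) :=
    Submodule.add_mem _ (Submodule.sub_mem _ (X_sub_C_mul_mem_degreeLT hq z)
      (C_mul_mem_degreeLT (H.mem_degreeLT (by omega)) _)) (C_mul_mem_degreeLT hlead _)
  have hf2 : f = C (f.coeff n) * p n := by
    refine H.eq_C_mul hf1 fun g hg => ?_
    have hg' : g ∈ degreeLT ℝ (n + 1) :=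
      degreeLT_coeff.2 fun m hm => degreeLT_coeff.1 hg m (by omega)
    have hXg := X_sub_C_mul_mem_degreeLT hg z
    set c := ((X - C z) * g).coeff n
    have e : g * f = q * ((X - C z) * g - C c * p n) + C c * (p n * q)
        - C (κ - M (p (n + 1) * p n) / h n) * (p n * g)
        + C (M (p n * p n) / h n) * (p n * ((X - C z) * g) - p (n + 1) * g) := by
      rw [hf]; ring
    have e2 : p n * ((X - C z) * g - C c * p n) = (X - C z) * (p n * g) - C c * (p n * p n) := by
      ring
    rw [e, map_add, map_sub, map_add, map_C_mul, map_C_mul, map_C_mul, map_sub,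
      hqL _ (H.sub_mem_degreeLT hXg), e2, map_sub, hM, map_C_mul, H.mul_eq_zero hq,
      H.mul_eq_zero hg, H.mul_eq_zero hg', H.mul_eq_coeff hXg]
    have := H.ne_zero n
    field_simp
    ring
  have hf3 : f.eval z = 0 := by
    rw [hf, H.pole_succ' hM, H.pole_self hM]
    have := H.ne_zero n
    simp
    field_simp
    ring
  rw [hf2, eval_mul, eval_C] at hf3
  rw [(_root_.mul_eq_zero.1 hf3).resolve_right hz] at hf2
  rw [C_0, zero_mul] at hf2
  linear_combination hf2

end Pole

end IsOrthogonalFor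

open Set Filter Topology MeasureTheory

/-! ### Integration against a weight as a linear functional -/

/-- The functional `f ↦ ∫₀¹ f u` on polynomials, defined through the moments of `u` so that it is
linear for every `u`; it is the integral when `u` is integrable, see `integralAgainst_apply`. -/
def integralAgainst (u : ℝ → ℝ) : ℝ[X] →ₗ[ℝ] ℝ :=
  Polynomial.lsum fun k => (∫ x in (0 : ℝ)..1, x ^ k * u x) • LinearMap.id

lemma integralAgainst_eq_sum (u : ℝ → ℝ) {f : ℝ[X]} {N : ℕ} (hf : f.natDegree < N) :
    integralAgainst u f = ∑ k ∈ Finset.range N, f.coeff k * ∫ x in (0 : ℝ)..1, x ^ k * u x := by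
  rw [integralAgainst, lsum_apply, sum_over_range' _ (by simp) N hf]
  simp [mul_comm]

lemma integralAgainst_apply {u : ℝ → ℝ} (hu : IntervalIntegrable u volume 0 1) (f : ℝ[X]) :
    integralAgainst u f = ∫ x in (0 : ℝ)..1, f.eval x * u x := by
  rw [integralAgainst_eq_sum u (Nat.lt_succ_self f.natDegree)]
  simp_rw [← intervalIntegral.integral_const_mul]
  rw [← intervalIntegral.integral_finsetSum]
  · refine intervalIntegral.integral_congr fun x _ => ?_
    simp only [eval_eq_sum_range, Finset.sum_mul]
    exact Finset.sum_congr rfl fun k _ => by ring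
  · intro k _
    exact (hu.continuousOn_mul (continuous_pow k).continuousOn).const_mul _

lemma intervalIntegrable_eval_mul {u : ℝ → ℝ} (hu : IntervalIntegrable u volume 0 1) (f : ℝ[X]) :
    IntervalIntegrable (fun x => f.eval x * u x) volume 0 1 :=
  hu.continuousOn_mul f.continuous.continuousOn

lemma integralAgainst_X_sub_C_mul {u v : ℝ → ℝ} (hu : IntervalIntegrable u volume 0 1)
    (hv : IntervalIntegrable v volume 0 1) {z κ : ℝ}
    (huv : ∀ x ∈ Icc (0 : ℝ) 1, (x - z) * u x = κ * v x) (f : ℝ[X]) :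
    integralAgainst u ((X - C z) * f) = κ * integralAgainst v f := by
  rw [integralAgainst_apply hu, integralAgainst_apply hv, ← intervalIntegral.integral_const_mul]
  refine intervalIntegral.integral_congr fun x hx => ?_
  rw [uIcc_of_le zero_le_one] at hx
  simp only [eval_mul, eval_sub, eval_X, eval_C]
  linear_combination f.eval x * huv x hx

/-- A polynomial depending on a parameter has the derivative `f'` at `t`, coefficient by
coefficient. -/
def HasCoeffDerivAt (f : ℝ → ℝ[X]) (f' : ℝ[X]) (t : ℝ) : Prop :=
  ∀ k, HasDerivAt (fun s => (f s).coeff k) (f'.coeff k) t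

namespace HasCoeffDerivAt

variable {f g : ℝ → ℝ[X]} {f' g' : ℝ[X]} {t : ℝ}

lemma const (p : ℝ[X]) (t : ℝ) : HasCoeffDerivAt (fun _ => p) 0 t := fun k => by
  simpa using hasDerivAt_const t (p.coeff k)

lemma mul (hf : HasCoeffDerivAt f f' t) (hg : HasCoeffDerivAt g g' t) :
    HasCoeffDerivAt (fun s => f s * g s) (f' * g t + f t * g') t := by
  intro k
  simp only [coeff_add, coeff_mul, ← Finset.sum_add_distrib]
  exact HasDerivAt.fun_sum fun i _ => (hf i.1).mul (hg i.2)

lemma C_of {a : ℝ → ℝ} {a' : ℝ} (ha : HasDerivAt a a' t) :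
    HasCoeffDerivAt (fun s => C (a s)) (C a') t := by
  intro k
  rcases Nat.eq_zero_or_pos k with rfl | hk
  · simpa using ha
  · simpa [coeff_C, hk.ne'] using hasDerivAt_const t (0 : ℝ)

lemma sub (hf : HasCoeffDerivAt f f' t) (hg : HasCoeffDerivAt g g' t) :
    HasCoeffDerivAt (fun s => f s - g s) (f' - g') t := fun k => by
  simpa using (hf k).fun_sub (hg k)

lemma sum {ι : Type*} {s : Finset ι} {f : ι → ℝ → ℝ[X]} {f' : ι → ℝ[X]}
    (hf : ∀ i ∈ s, HasCoeffDerivAt (f i) (f' i) t) :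
    HasCoeffDerivAt (fun r => ∑ i ∈ s, f i r) (∑ i ∈ s, f' i) t := by
  intro k
  simp only [finsetSum_coeff]
  exact HasDerivAt.fun_sum fun i hi => hf i hi k

/-- A derivative in `t` does not raise the degree: leading coefficients that are constant in `t`
disappear. -/
lemma mem_degreeLT (hf : HasCoeffDerivAt f f' t) {n : ℕ}
    (h : ∀ k, n ≤ k → ∀ s, (f s).coeff k = (f t).coeff k) : f' ∈ degreeLT ℝ n := by
  rw [degreeLT_coeff]
  intro k hk
  refine (hf k).unique ?_
  rw [funext (h k hk)]
  exact hasDerivAt_const _ _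

/-- Product rule for the integral of a varying polynomial against a varying weight. -/
lemma integralAgainst (hf : HasCoeffDerivAt f f' t) {u : ℝ → ℝ → ℝ} {D : ℝ[X] →ₗ[ℝ] ℝ} {N : ℕ}
    (hN : ∀ s, (f s).natDegree < N)
    (hu : ∀ k : ℕ, HasDerivAt (fun s => ∫ x in (0 : ℝ)..1, x ^ k * u s x) (D (X ^ k)) t) :
    HasDerivAt (fun s => GenJacobi.integralAgainst (u s) (f s))
      (GenJacobi.integralAgainst (u t) f' + D (f t)) t := by
  have hf' : f'.natDegree < N := by
    have h1 : f' ∈ degreeLT ℝ N := hf.mem_degreeLT fun k hk s => by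
      rw [coeff_eq_zero_of_natDegree_lt ((hN s).trans_le hk),
        coeff_eq_zero_of_natDegree_lt ((hN t).trans_le hk)]
    by_cases h0 : f' = 0
    · rw [h0, natDegree_zero]; exact (Nat.zero_le _).trans_lt (hN t)
    · rw [Polynomial.mem_degreeLT, degree_eq_natDegree h0] at h1
      exact_mod_cast h1
  have hD : D (f t) = ∑ k ∈ Finset.range N, (f t).coeff k * D (X ^ k) := by
    conv_lhs => rw [(f t).as_sum_range_C_mul_X_pow' (hN t)]
    simp only [map_sum, map_C_mul]
  rw [hD, integralAgainst_eq_sum _ hf', ← Finset.sum_add_distrib]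
  simp only [fun s => integralAgainst_eq_sum (u s) (hN s)]
  exact HasDerivAt.fun_sum fun k _ => (hf k).mul (hu k)

end HasCoeffDerivAt

/-! ### The generalized Jacobi weight -/

section Weight

variable {α β γ t : ℝ}

lemma sub_pos_of_mem (ht : t < 0) {x : ℝ} (hx : x ∈ Icc (0 : ℝ) 1) : 0 < x - t := by
  linarith [hx.1]

lemma continuousOn_sub_rpow (ht : t < 0) (γ : ℝ) :
    ContinuousOn (fun x : ℝ => (x - t) ^ γ) (Icc 0 1) :=
  (continuousOn_id.sub continuousOn_const).rpow_const fun _ hx =>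
    Or.inl (sub_pos_of_mem ht hx).ne'

lemma continuousOn_weight (hα : 0 < α) (hβ : 0 < β) (ht : t < 0) :
    ContinuousOn (weight α β γ t) (Icc 0 1) := by
  refine ((continuousOn_sub_rpow ht γ).mul ?_).mul ?_
  · exact (Real.continuous_rpow_const hα.le).continuousOn
  · exact ((Real.continuous_rpow_const hβ.le).comp (continuous_const.sub continuous_id)).continuousOn

lemma weight_nonneg (ht : t < 0) {x : ℝ} (hx : x ∈ Icc (0 : ℝ) 1) : 0 ≤ weight α β γ t x := by
  have h1 := sub_pos_of_mem ht hx
  have h2 := sub_nonneg.2 hx.2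
  have h3 := hx.1
  unfold weight
  positivity

lemma weight_pos (ht : t < 0) {x : ℝ} (hx : x ∈ Ioo (0 : ℝ) 1) : 0 < weight α β γ t x := by
  have h1 := sub_pos_of_mem ht (Ioo_subset_Icc_self hx)
  have h2 := sub_pos.2 hx.2
  have h3 := hx.1
  unfold weight
  positivity

lemma weight_zero (hα : 0 < α) : weight α β γ t 0 = 0 := by
  simp [weight, Real.zero_rpow hα.ne']

lemma weight_one (hβ : 0 < β) : weight α β γ t 1 = 0 := by
  simp [weight, Real.zero_rpow hβ.ne']

lemma intervalIntegrable_rpow_div (hα : 0 < α) :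
    IntervalIntegrable (fun x : ℝ => x ^ α / x) volume 0 1 := by
  refine (intervalIntegral.intervalIntegrable_rpow' (r := α - 1) (by linarith)).congr ?_
  intro x hx
  rw [uIoc_of_le zero_le_one] at hx
  exact Real.rpow_sub_one hx.1.ne' α

lemma intervalIntegrable_one_sub_rpow_div (hβ : 0 < β) :
    IntervalIntegrable (fun x : ℝ => (1 - x) ^ β / (1 - x)) volume 0 1 := by
  simpa using ((intervalIntegrable_rpow_div hβ).comp_sub_left 1).symm

lemma intervalIntegrable_weight (hα : 0 < α) (hβ : 0 < β) (ht : t < 0) :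
    IntervalIntegrable (weight α β γ t) volume 0 1 :=
  ContinuousOn.intervalIntegrable (by
    rw [uIcc_of_le zero_le_one]; exact continuousOn_weight hα hβ ht)

lemma intervalIntegrable_weight_div (hα : 0 < α) (hβ : 0 < β) (ht : t < 0) :
    IntervalIntegrable (fun x => weight α β γ t x / x) volume 0 1 := by
  have h : ContinuousOn (fun x : ℝ => (x - t) ^ γ * (1 - x) ^ β) (uIcc 0 1) := by
    rw [uIcc_of_le zero_le_one]
    exact (continuousOn_sub_rpow ht γ).mul
      ((Real.continuous_rpow_const hβ.le).comp (continuous_const.sub continuous_id)).continuousOn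
  refine ((intervalIntegrable_rpow_div hα).continuousOn_mul h).congr fun x _ => ?_
  simp only [weight]; ring

lemma intervalIntegrable_weight_div_sub (hα : 0 < α) (hβ : 0 < β) (ht : t < 0) :
    IntervalIntegrable (fun x => weight α β γ t x / (x - t)) volume 0 1 :=
  ContinuousOn.intervalIntegrable (by
    rw [uIcc_of_le zero_le_one]
    exact (continuousOn_weight hα hβ ht).div (continuousOn_id.sub continuousOn_const)
      fun x hx => (sub_pos_of_mem ht hx).ne')

lemma intervalIntegrable_weight_div_one_sub (hα : 0 < α) (hβ : 0 < β) (ht : t < 0) :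
    IntervalIntegrable (fun x => weight α β γ t x / (1 - x)) volume 0 1 := by
  have h : ContinuousOn (fun x : ℝ => (x - t) ^ γ * x ^ α) (uIcc 0 1) := by
    rw [uIcc_of_le zero_le_one]
    exact (continuousOn_sub_rpow ht γ).mul (Real.continuous_rpow_const hα.le).continuousOn
  refine ((intervalIntegrable_one_sub_rpow_div hβ).continuousOn_mul h).congr fun x _ => ?_
  simp only [weight]; ring

lemma hasDerivAt_weight (ht : t < 0) {x : ℝ} (hx : x ∈ Ioo (0 : ℝ) 1) :
    HasDerivAt (weight α β γ t) (α * (weight α β γ t x / x) + γ * (weight α β γ t x / (x - t))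
      - β * (weight α β γ t x / (1 - x))) x := by
  have h1 := (sub_pos_of_mem ht (Ioo_subset_Icc_self hx)).ne'
  have h2 := (sub_pos.2 hx.2).ne'
  have h3 := hx.1.ne'
  have d1 := ((hasDerivAt_id x).sub_const t).rpow_const (p := γ) (Or.inl h1)
  have d2 := (hasDerivAt_id x).rpow_const (p := α) (Or.inl h3)
  have d3 := ((hasDerivAt_id x).const_sub 1).rpow_const (p := β) (Or.inl h2)
  refine ((d1.mul d2).mul d3).congr_deriv ?_
  simp only [id_eq, Real.rpow_sub_one h1, Real.rpow_sub_one h2, Real.rpow_sub_one h3, weight,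
    Pi.mul_apply]
  field_simp
  ring

/-- Differentiation under the integral sign of the factor `(x - t) ^ γ`, against any integrable
function. -/
lemma hasDerivAt_integral_mul_sub_rpow {φ : ℝ → ℝ} (hφ : IntervalIntegrable φ volume 0 1) (γ : ℝ)
    (ht : t < 0) :
    HasDerivAt (fun s => ∫ x in (0 : ℝ)..1, φ x * (x - s) ^ γ)
      (∫ x in (0 : ℝ)..1, φ x * (-(γ * (x - t) ^ (γ - 1)))) t := by
  have hcont : ∀ (s δ : ℝ), s < 0 → ContinuousOn (fun x : ℝ => (x - s) ^ δ) (uIcc 0 1) := by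
    intro s δ hs
    rw [uIcc_of_le zero_le_one]
    exact continuousOn_sub_rpow hs δ
  -- for `s` near `t`, `x - s` ranges over a compact interval of positive numbers
  obtain ⟨K, hK⟩ := (isCompact_Icc (a := -t / 2) (b := 1 - 2 * t)).exists_bound_of_continuousOn
    (f := fun y : ℝ => -(γ * y ^ (γ - 1))) (by
      refine (continuousOn_const.mul (continuousOn_id.rpow_const fun y hy => Or.inl ?_)).neg
      have := hy.1
      simp only [id_eq]
      linarith)
  refine (intervalIntegral.hasDerivAt_integral_of_dominated_loc_of_deriv_le
    (s := Ioo (2 * t) (t / 2)) (bound := fun x => ‖φ x‖ * K)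
    (F' := fun s x => φ x * (-(γ * (x - s) ^ (γ - 1))))
    (Ioo_mem_nhds (by linarith) (by linarith)) ?_ ?_ ?_ ?_ ?_ ?_).2
  · filter_upwards [Iio_mem_nhds ht] with s hs
    exact (hφ.mul_continuousOn (hcont s γ hs)).def'.aestronglyMeasurable
  · exact hφ.mul_continuousOn (hcont t γ ht)
  · exact (hφ.mul_continuousOn
      (continuousOn_const.mul (hcont t (γ - 1) ht)).neg).def'.aestronglyMeasurable
  · refine ae_of_all _ fun x hx s hs => ?_
    rw [uIoc_of_le zero_le_one] at hx
    rw [norm_mul]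
    exact mul_le_mul_of_nonneg_left
      (hK (x - s) ⟨by linarith [hx.1, hs.2], by linarith [hx.2, hs.1]⟩) (norm_nonneg _)
  · exact hφ.norm.mul_const K
  · refine ae_of_all _ fun x hx s hs => ?_
    rw [uIoc_of_le zero_le_one] at hx
    have h1 : x - s ≠ 0 := by
      have := hx.1; have := hs.2
      linarith
    have := (((hasDerivAt_id s).const_sub x).rpow_const (p := γ) (Or.inl h1)).const_mul (φ x)
    refine this.congr_deriv ?_
    simp only [id_eq]
    ring

end Weight

/-! ### The four functionals of the weight -/

section Functionals

variable (α β γ t : ℝ)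

/-- `f ↦ ∫₀¹ f w`. -/
def weightFun : ℝ[X] →ₗ[ℝ] ℝ := integralAgainst (weight α β γ t)

/-- `f ↦ α ∫₀¹ f w / x`. -/
def poleZero : ℝ[X] →ₗ[ℝ] ℝ := α • integralAgainst fun x => weight α β γ t x / x

/-- `f ↦ γ ∫₀¹ f w / (x - t)`. -/
def poleT : ℝ[X] →ₗ[ℝ] ℝ := γ • integralAgainst fun x => weight α β γ t x / (x - t)

/-- `f ↦ β ∫₀¹ f w / (1 - x)`. -/
def poleOne : ℝ[X] →ₗ[ℝ] ℝ := β • integralAgainst fun x => weight α β γ t x / (1 - x)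

variable {α β γ t}

lemma form_eq (hα : 0 < α) (hβ : 0 < β) (ht : t < 0) (p q : ℝ[X]) :
    form (weight α β γ t) p q = weightFun α β γ t (p * q) := by
  rw [weightFun, integralAgainst_apply (intervalIntegrable_weight hα hβ ht), form]
  simp only [eval_mul]

lemma poleZero_mul (hα : 0 < α) (hβ : 0 < β) (ht : t < 0) (f : ℝ[X]) :
    poleZero α β γ t ((X - C 0) * f) = α * weightFun α β γ t f := by
  rw [poleZero, LinearMap.smul_apply, integralAgainst_X_sub_C_mul (κ := 1)
    (intervalIntegrable_weight_div hα hβ ht) (intervalIntegrable_weight (γ := γ) hα hβ ht), weightFun]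
  · simp
  · intro x _
    rcases eq_or_ne x 0 with rfl | h0
    · simp [weight_zero hα]
    · field_simp
      ring

lemma poleT_mul (hα : 0 < α) (hβ : 0 < β) (ht : t < 0) (f : ℝ[X]) :
    poleT α β γ t ((X - C t) * f) = γ * weightFun α β γ t f := by
  rw [poleT, LinearMap.smul_apply, integralAgainst_X_sub_C_mul (κ := 1)
    (intervalIntegrable_weight_div_sub hα hβ ht) (intervalIntegrable_weight (γ := γ) hα hβ ht), weightFun]
  · simp
  · intro x hx
    have := (sub_pos_of_mem ht hx).ne'
    field_simp

lemma poleOne_mul (hα : 0 < α) (hβ : 0 < β) (ht : t < 0) (f : ℝ[X]) :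
    poleOne α β γ t ((X - C 1) * f) = -β * weightFun α β γ t f := by
  rw [poleOne, LinearMap.smul_apply, integralAgainst_X_sub_C_mul (κ := -1)
    (intervalIntegrable_weight_div_one_sub hα hβ ht) (intervalIntegrable_weight (γ := γ) hα hβ ht),
    weightFun]
  · simp
  · intro x _
    rcases eq_or_ne x 1 with rfl | h1
    · simp [weight_one hβ]
    · have : 1 - x ≠ 0 := sub_ne_zero.2 h1.symm
      field_simp
      ring

/-- Integration by parts; the boundary terms vanish because `α, β > 0`. -/
lemma weightFun_derivative (hα : 0 < α) (hβ : 0 < β) (ht : t < 0) (f : ℝ[X]) :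
    weightFun α β γ t (derivative f) + poleZero α β γ t f + poleT α β γ t f
      - poleOne α β γ t f = 0 := by
  have i0 := intervalIntegrable_eval_mul (intervalIntegrable_weight (γ := γ) hα hβ ht) (derivative f)
  have i1 := (intervalIntegrable_eval_mul
    (intervalIntegrable_weight_div (γ := γ) hα hβ ht) f).const_mul α
  have i2 := (intervalIntegrable_eval_mul
    (intervalIntegrable_weight_div_sub (γ := γ) hα hβ ht) f).const_mul γ
  have i3 := (intervalIntegrable_eval_mul
    (intervalIntegrable_weight_div_one_sub (γ := γ) hα hβ ht) f).const_mul β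
  have key := intervalIntegral.integral_eq_sub_of_hasDerivAt_of_le zero_le_one
    (f.continuous.continuousOn.mul (continuousOn_weight (γ := γ) hα hβ ht))
    (fun x hx => ((f.hasDerivAt x).mul (hasDerivAt_weight (γ := γ) ht hx)).congr_deriv
      (show _ = (derivative f).eval x * weight α β γ t x + α * (f.eval x * (weight α β γ t x / x))
        + γ * (f.eval x * (weight α β γ t x / (x - t)))
        - β * (f.eval x * (weight α β γ t x / (1 - x))) by ring))
    (((i0.add i1).add i2).sub i3)
  rw [intervalIntegral.integral_sub ((i0.add i1).add i2) i3,
    intervalIntegral.integral_add (i0.add i1) i2, intervalIntegral.integral_add i0 i1,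
    intervalIntegral.integral_const_mul, intervalIntegral.integral_const_mul,
    intervalIntegral.integral_const_mul] at key
  simp only [weightFun, poleZero, poleT, poleOne, LinearMap.smul_apply, smul_eq_mul]
  rw [integralAgainst_apply (intervalIntegrable_weight hα hβ ht),
    integralAgainst_apply (intervalIntegrable_weight_div hα hβ ht),
    integralAgainst_apply (intervalIntegrable_weight_div_sub hα hβ ht),
    integralAgainst_apply (intervalIntegrable_weight_div_one_sub hα hβ ht), key,
    Pi.mul_apply, Pi.mul_apply, weight_one hβ, weight_zero hα]
  ring

lemma weightFun_mul_self_pos (hα : 0 < α) (hβ : 0 < β) (ht : t < 0) {f : ℝ[X]} (hf : f ≠ 0) :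
    0 < weightFun α β γ t (f * f) := by
  rw [weightFun, integralAgainst_apply (intervalIntegrable_weight hα hβ ht)]
  -- `f` has finitely many roots, so it does not vanish at some point of `(0, 1)`
  obtain ⟨c, hc, hfc⟩ : ∃ c ∈ Ioo (0 : ℝ) 1, f.eval c ≠ 0 := by
    by_contra! hcon
    exact hf (f.eq_zero_of_infinite_isRoot ((Ioo_infinite zero_lt_one).mono hcon))
  refine intervalIntegral.integral_pos zero_lt_one
    ((f * f).continuous.continuousOn.mul (continuousOn_weight hα hβ ht)) (fun x hx => ?_)
    ⟨c, Ioo_subset_Icc_self hc, ?_⟩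
  · rw [eval_mul]
    exact mul_nonneg (mul_self_nonneg _) (weight_nonneg ht ⟨hx.1.le, hx.2⟩)
  · rw [eval_mul]
    exact mul_pos (mul_self_pos.2 hfc) (weight_pos ht hc)

/-- A functional whose density is bounded below by a positive multiple of the weight is positive on
squares. -/
lemma integralAgainst_mul_self_pos (hα : 0 < α) (hβ : 0 < β) (ht : t < 0) {f : ℝ[X]} (hf : f ≠ 0)
    {u : ℝ → ℝ} (hu : IntervalIntegrable u volume 0 1) {c : ℝ} (hc : 0 < c)
    (hle : ∀ x ∈ Ioo (0 : ℝ) 1, c * weight α β γ t x ≤ u x) : 0 < integralAgainst u (f * f) := by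
  refine (mul_pos hc (weightFun_mul_self_pos (γ := γ) hα hβ ht hf)).trans_le ?_
  have hw := intervalIntegrable_weight (γ := γ) hα hβ ht
  rw [weightFun, integralAgainst_apply hw, integralAgainst_apply hu,
    ← intervalIntegral.integral_const_mul]
  refine intervalIntegral.integral_mono_on_of_le_Ioo zero_le_one
    ((intervalIntegrable_eval_mul hw _).const_mul c) (intervalIntegrable_eval_mul hu _)
    fun x hx => ?_
  rw [eval_mul]
  have := mul_le_mul_of_nonneg_left (hle x hx) (mul_self_nonneg (f.eval x))
  linarith

lemma poleZero_mul_self_pos (hα : 0 < α) (hβ : 0 < β) (ht : t < 0) {f : ℝ[X]} (hf : f ≠ 0) :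
    0 < poleZero α β γ t (f * f) := by
  refine mul_pos hα (integralAgainst_mul_self_pos (γ := γ) hα hβ ht hf
    (intervalIntegrable_weight_div hα hβ ht) one_pos fun x hx => ?_)
  rw [one_mul, le_div_iff₀ hx.1]
  exact mul_le_of_le_one_right (weight_pos ht hx).le hx.2.le

lemma poleOne_mul_self_pos (hα : 0 < α) (hβ : 0 < β) (ht : t < 0) {f : ℝ[X]} (hf : f ≠ 0) :
    0 < poleOne α β γ t (f * f) := by
  refine mul_pos hβ (integralAgainst_mul_self_pos (γ := γ) hα hβ ht hf
    (intervalIntegrable_weight_div_one_sub hα hβ ht) one_pos fun x hx => ?_)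
  rw [one_mul, le_div_iff₀ (sub_pos.2 hx.2)]
  exact mul_le_of_le_one_right (weight_pos ht hx).le (by linarith [hx.1])

lemma poleT_mul_self_ne_zero (hα : 0 < α) (hβ : 0 < β) (hγ : γ ≠ 0) (ht : t < 0) {f : ℝ[X]}
    (hf : f ≠ 0) : poleT α β γ t (f * f) ≠ 0 := by
  have h1 : 0 < 1 - t := by linarith
  refine mul_ne_zero hγ (integralAgainst_mul_self_pos (γ := γ) hα hβ ht hf
    (intervalIntegrable_weight_div_sub hα hβ ht) (inv_pos.2 h1) fun x hx => ?_).ne'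
  rw [inv_mul_eq_div]
  exact div_le_div_of_nonneg_left (weight_pos ht hx).le
    (sub_pos_of_mem ht (Ioo_subset_Icc_self hx)) (by linarith [hx.2])

/-- `d/dt` of the weight is `-γ w / (x - t)`. -/
lemma hasDerivAt_weightFun (hα : 0 < α) (hβ : 0 < β) (ht : t < 0) {f : ℝ → ℝ[X]} {f' : ℝ[X]}
    {N : ℕ} (hN : ∀ s, (f s).natDegree < N) (hf : HasCoeffDerivAt f f' t) :
    HasDerivAt (fun s => weightFun α β γ s (f s))
      (weightFun α β γ t f' - poleT α β γ t (f t)) t := by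
  have := hf.integralAgainst (u := weight α β γ) (D := -poleT α β γ t) hN fun k => ?_
  · simpa [sub_eq_add_neg, weightFun] using this
  have hφ : IntervalIntegrable (fun x : ℝ => x ^ k * (x ^ α * (1 - x) ^ β)) volume 0 1 :=
    ((continuous_pow k).mul ((Real.continuous_rpow_const hα.le).mul
      ((Real.continuous_rpow_const hβ.le).comp
        (continuous_const.sub continuous_id)))).intervalIntegrable _ _
  have key := hasDerivAt_integral_mul_sub_rpow hφ γ ht
  convert! key using 1
  · funext s
    exact intervalIntegral.integral_congr fun x _ => by simp only [weight]; ring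
  · rw [LinearMap.neg_apply, poleT, LinearMap.smul_apply, smul_eq_mul,
      integralAgainst_apply (intervalIntegrable_weight_div_sub hα hβ ht),
      ← intervalIntegral.integral_const_mul, ← intervalIntegral.integral_neg]
    refine intervalIntegral.integral_congr fun x hx => ?_
    rw [uIcc_of_le zero_le_one] at hx
    simp only [weight, eval_pow, eval_X, Real.rpow_sub_one (sub_pos_of_mem ht hx).ne']
    ring

/-- The density `w / ((1 - x) (x - t))` of the derivative is split into partial fractions. -/
lemma hasDerivAt_poleOne (hα : 0 < α) (hβ : 0 < β) (ht : t < 0) {f : ℝ → ℝ[X]} {f' : ℝ[X]}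
    {N : ℕ} (hN : ∀ s, (f s).natDegree < N) (hf : HasCoeffDerivAt f f' t) :
    HasDerivAt (fun s => poleOne α β γ s (f s))
      (poleOne α β γ t f' -
        (β * poleT α β γ t (f t) + γ * poleOne α β γ t (f t)) / (1 - t)) t := by
  have ht1 : 1 - t ≠ 0 := by linarith
  have := (hf.integralAgainst (u := fun s x => weight α β γ s x / (1 - x))
    (D := -(γ / (1 - t)) • ((integralAgainst fun x => weight α β γ t x / (x - t)) +
      integralAgainst fun x => weight α β γ t x / (1 - x))) hN fun k => ?_).const_mul β
  · simp only [poleOne, poleT, LinearMap.smul_apply, smul_eq_mul] at this ⊢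
    refine this.congr_deriv ?_
    rw [LinearMap.add_apply]
    field_simp
    ring
  have hφ : IntervalIntegrable (fun x : ℝ => (x ^ k * x ^ α) * ((1 - x) ^ β / (1 - x)))
      volume 0 1 :=
    (intervalIntegrable_one_sub_rpow_div hβ).continuousOn_mul
      ((continuous_pow k).mul (Real.continuous_rpow_const hα.le)).continuousOn
  have key := hasDerivAt_integral_mul_sub_rpow hφ γ ht
  convert! key using 1
  · funext s
    exact intervalIntegral.integral_congr fun x _ => by simp only [weight]; ring
  · have i1 := intervalIntegrable_eval_mul
      (intervalIntegrable_weight_div_sub (γ := γ) hα hβ ht) (X ^ k)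
    have i2 := intervalIntegrable_eval_mul
      (intervalIntegrable_weight_div_one_sub (γ := γ) hα hβ ht) (X ^ k)
    rw [LinearMap.smul_apply, LinearMap.add_apply, smul_eq_mul,
      integralAgainst_apply (intervalIntegrable_weight_div_sub hα hβ ht),
      integralAgainst_apply (intervalIntegrable_weight_div_one_sub hα hβ ht),
      ← intervalIntegral.integral_add i1 i2, ← intervalIntegral.integral_const_mul]
    refine intervalIntegral.integral_congr fun x hx => ?_
    rw [uIcc_of_le zero_le_one] at hx
    have hx' := (sub_pos_of_mem ht hx).ne'
    simp only [weight, eval_pow, eval_X, Real.rpow_sub_one hx']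
    rcases eq_or_ne x 1 with rfl | h1
    · simp [Real.zero_rpow hβ.ne']
    · have : 1 - x ≠ 0 := sub_ne_zero.2 h1.symm
      field_simp
      ring

end Functionals

/-! ### The orthogonal polynomials of the weight and their `t`-derivatives -/

lemma monicOP_eq (w : ℝ → ℝ) (n : ℕ) : monicOP w n = X ^ n - ∑ k ∈ Finset.range n,
    C (form w (X ^ n) (monicOP w k) / form w (monicOP w k) (monicOP w k)) * monicOP w k := by
  rw [monicOP, Finset.sum_range]

lemma monicOP_monic_natDegree (w : ℝ → ℝ) (n : ℕ) :
    (monicOP w n).Monic ∧ (monicOP w n).natDegree = n := by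
  induction n using Nat.strong_induction_on with
  | _ n ih =>
    have hlt : (∑ k ∈ Finset.range n, C (form w (X ^ n) (monicOP w k) /
        form w (monicOP w k) (monicOP w k)) * monicOP w k).degree < (X ^ n : ℝ[X]).degree := by
      rw [degree_X_pow, ← mem_degreeLT]
      refine Submodule.sum_mem _ fun k hk => C_mul_mem_degreeLT ?_ _
      have hk := Finset.mem_range.1 hk
      rw [degreeLT_coeff]
      intro m hm
      exact coeff_eq_zero_of_natDegree_lt (by rw [(ih k hk).2]; omega)
    rw [monicOP_eq]
    exact ⟨(monic_X_pow n).sub_of_left hlt, natDegree_eq_of_degree_eq_some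
      ((degree_sub_eq_left_of_degree_lt hlt).trans (degree_X_pow n))⟩

section

variable {α β γ t : ℝ}

lemma P_monic (n : ℕ) (t : ℝ) : (P α β γ n t).Monic := (monicOP_monic_natDegree _ n).1

lemma P_natDegree (n : ℕ) (t : ℝ) : (P α β γ n t).natDegree = n := (monicOP_monic_natDegree _ n).2

lemma P_ne_zero (n : ℕ) (t : ℝ) : P α β γ n t ≠ 0 := (P_monic n t).ne_zero

lemma h_pos (hα : 0 < α) (hβ : 0 < β) (ht : t < 0) (n : ℕ) : 0 < h α β γ n t := by
  rw [h, form_eq hα hβ ht]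
  exact weightFun_mul_self_pos hα hβ ht (P_ne_zero n t)

lemma weightFun_P_mul_of_lt (hα : 0 < α) (hβ : 0 < β) (ht : t < 0) (n : ℕ) :
    ∀ m < n, weightFun α β γ t (P α β γ m t * P α β γ n t) = 0 := by
  induction n using Nat.strong_induction_on with
  | _ n ih =>
    intro m hm
    have hPn : P α β γ n t = X ^ n - ∑ k ∈ Finset.range n,
        C (weightFun α β γ t (X ^ n * P α β γ k t) / h α β γ k t) * P α β γ k t := by
      rw [P, monicOP_eq]
      simp only [form_eq hα hβ ht]
      simp only [h, form_eq hα hβ ht, P]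
    rw [hPn, mul_sub, map_sub, Finset.mul_sum, map_sum,
      Finset.sum_eq_single_of_mem m (Finset.mem_range.2 hm)]
    · have := (h_pos (γ := γ) hα hβ ht m).ne'
      rw [mul_left_comm, map_C_mul, ← form_eq hα hβ ht (P α β γ m t) (P α β γ m t), ← h,
        mul_comm (P α β γ m t)]
      field_simp
      ring
    · intro k hk hkm
      rw [mul_left_comm, map_C_mul]
      rcases lt_or_gt_of_ne hkm with hlt | hlt
      · rw [mul_comm (P α β γ m t), ih m hm k hlt, mul_zero]
      · rw [ih k (Finset.mem_range.1 hk) m hlt, mul_zero]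

lemma isOrthogonalFor (hα : 0 < α) (hβ : 0 < β) (ht : t < 0) :
    IsOrthogonalFor (weightFun α β γ t) (fun n => P α β γ n t) (fun n => h α β γ n t) where
  monic n := P_monic n t
  natDegree_eq n := P_natDegree n t
  orthogonal m n := by
    split_ifs with hmn
    · rw [hmn, h, form_eq hα hβ ht]
    · rcases lt_or_gt_of_ne hmn with hlt | hlt
      · exact weightFun_P_mul_of_lt hα hβ ht n m hlt
      · rw [mul_comm]
        exact weightFun_P_mul_of_lt hα hβ ht m n hlt
  ne_zero n := (h_pos hα hβ ht n).ne'

lemma hasDerivAt_form (hα : 0 < α) (hβ : 0 < β) (ht : t < 0) {p q : ℝ → ℝ[X]} {p' q' : ℝ[X]}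
    {N : ℕ} (hN : ∀ s, (p s * q s).natDegree < N) (hp : HasCoeffDerivAt p p' t)
    (hq : HasCoeffDerivAt q q' t) :
    HasDerivAt (fun s => form (weight α β γ s) (p s) (q s))
      (weightFun α β γ t (p' * q t + p t * q') - poleT α β γ t (p t * q t)) t := by
  refine (hasDerivAt_weightFun hα hβ ht hN (hp.mul hq)).congr_of_eventuallyEq ?_
  filter_upwards [Iio_mem_nhds ht] with s hs
  exact form_eq hα hβ hs _ _

lemma natDegree_mul_P_lt (f : ℝ[X]) (n : ℕ) (s : ℝ) :
    (f * P α β γ n s).natDegree < f.natDegree + n + 1 := by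
  have := natDegree_mul_le (p := f) (q := P α β γ n s)
  rw [P_natDegree] at this
  omega

lemma natDegree_P_mul_P_lt (m n : ℕ) (s : ℝ) :
    (P α β γ m s * P α β γ n s).natDegree < m + n + 1 := by
  have := natDegree_mul_P_lt (α := α) (β := β) (γ := γ) (P α β γ m s) n s
  rwa [P_natDegree] at this

lemma exists_hasCoeffDerivAt_P (hα : 0 < α) (hβ : 0 < β) (ht : t < 0) (n : ℕ) :
    ∃ q, HasCoeffDerivAt (P α β γ n) q t := by
  induction n using Nat.strong_induction_on with
  | _ n ih =>
    have hPn : P α β γ n = fun s => X ^ n - ∑ k ∈ Finset.range n,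
        C (form (weight α β γ s) (X ^ n) (P α β γ k s) / h α β γ k s) * P α β γ k s := by
      funext s
      exact monicOP_eq _ n
    have hterm : ∀ k < n, ∃ q, HasCoeffDerivAt (fun s =>
        C (form (weight α β γ s) (X ^ n) (P α β γ k s) / h α β γ k s) * P α β γ k s) q t := by
      intro k hk
      obtain ⟨q, hq⟩ := ih k hk
      exact ⟨_, HasCoeffDerivAt.mul (HasCoeffDerivAt.C_of
        ((hasDerivAt_form hα hβ ht (natDegree_mul_P_lt (X ^ n) k)
          (HasCoeffDerivAt.const (X ^ n) t) hq).div
        (hasDerivAt_form hα hβ ht (natDegree_P_mul_P_lt k k) hq hq) (h_pos hα hβ ht k).ne')) hq⟩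
    choose! q hq using hterm
    rw [hPn]
    exact ⟨_, (HasCoeffDerivAt.const (X ^ n) t).sub
      (HasCoeffDerivAt.sum fun k hk => hq k (Finset.mem_range.1 hk))⟩

/-- The `t`-derivative `q` of `P n` has lower degree, and `q` represents the functional
`f ↦ γ ∫ P n f w / (x - t)` on polynomials of lower degree: this is the derivative of
`∫ P n f w = 0`. -/
lemma exists_deriv_P (hα : 0 < α) (hβ : 0 < β) (ht : t < 0) (n : ℕ) :
    ∃ q ∈ degreeLT ℝ n, HasCoeffDerivAt (P α β γ n) q t ∧
      ∀ f ∈ degreeLT ℝ n, weightFun α β γ t (q * f) = poleT α β γ t (P α β γ n t * f) := by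
  obtain ⟨q, hq⟩ := exists_hasCoeffDerivAt_P (γ := γ) hα hβ ht n
  refine ⟨q, hq.mem_degreeLT fun k hk s => ?_, hq, fun f hf => ?_⟩
  · rcases hk.eq_or_lt with rfl | hk
    · have h1 := (P_monic (α := α) (β := β) (γ := γ) n s).coeff_natDegree
      have h2 := (P_monic (α := α) (β := β) (γ := γ) n t).coeff_natDegree
      rw [P_natDegree] at h1 h2
      rw [h1, h2]
    · rw [coeff_eq_zero_of_natDegree_lt (by rwa [P_natDegree]),
        coeff_eq_zero_of_natDegree_lt (by rwa [P_natDegree])]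
  · have h1 := hasDerivAt_weightFun (γ := γ) hα hβ ht (N := f.natDegree + n + 1)
      (fun s => by rw [mul_comm]; exact natDegree_mul_P_lt f n s)
      (hq.mul (HasCoeffDerivAt.const f t))
    have h2 : (fun s => weightFun α β γ s (P α β γ n s * f)) =ᶠ[𝓝 t] fun _ => 0 := by
      filter_upwards [Iio_mem_nhds ht] with s hs
      exact (isOrthogonalFor hα hβ hs).mul_eq_zero hf
    have h3 := h1.unique ((hasDerivAt_const t (0 : ℝ)).congr_of_eventuallyEq h2)
    rw [mul_zero, add_zero] at h3
    linarith

/-! ### The auxiliary quantities and their relations -/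

lemma R_eq (hα : 0 < α) (hβ : 0 < β) (ht : t < 0) (n : ℕ) :
    R α β γ n t = poleOne α β γ t (P α β γ n t * P α β γ n t) / h α β γ n t := by
  rw [R, poleOne, LinearMap.smul_apply, smul_eq_mul,
    integralAgainst_apply (intervalIntegrable_weight_div_one_sub hα hβ ht), div_mul_eq_mul_div]
  simp only [integrandR, eval_mul]
  congr 2
  exact intervalIntegral.integral_congr fun x _ => by ring

variable (α β γ) in
/-- `(γ / h n) ∫₀¹ P n ^ 2 w / (x - t)`, the analogue of `R` at the pole `t`. -/
def poleTDiag (n : ℕ) (t : ℝ) : ℝ := poleT α β γ t (P α β γ n t * P α β γ n t) / h α β γ n t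

variable (α β γ) in
/-- `(β / h (n - 1)) ∫₀¹ P n P (n - 1) w / (1 - x)`, taken to be `0` for `n = 0`. -/
def poleOneOff : ℕ → ℝ → ℝ
  | 0, _ => 0
  | n + 1, t => poleOne α β γ t (P α β γ (n + 1) t * P α β γ n t) / h α β γ n t

variable (α β γ) in
/-- `(γ / h (n - 1)) ∫₀¹ P n P (n - 1) w / (x - t)`, taken to be `0` for `n = 0`. -/
def poleTOff : ℕ → ℝ → ℝ
  | 0, _ => 0
  | n + 1, t => poleT α β γ t (P α β γ (n + 1) t * P α β γ n t) / h α β γ n t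

lemma poleOne_X_mul (hα : 0 < α) (hβ : 0 < β) (ht : t < 0) (f : ℝ[X]) :
    poleOne α β γ t (X * f) = poleOne α β γ t f - β * weightFun α β γ t f := by
  have := poleOne_mul (γ := γ) hα hβ ht f
  rw [sub_mul, map_sub, C_1, one_mul] at this
  linarith

lemma poleT_X_mul (hα : 0 < α) (hβ : 0 < β) (ht : t < 0) (f : ℝ[X]) :
    poleT α β γ t (X * f) = t * poleT α β γ t f + γ * weightFun α β γ t f := by
  have := poleT_mul (γ := γ) hα hβ ht f
  rw [sub_mul, map_sub, map_C_mul] at this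
  linarith

lemma poleZero_X_mul (hα : 0 < α) (hβ : 0 < β) (ht : t < 0) (f : ℝ[X]) :
    poleZero α β γ t (X * f) = α * weightFun α β γ t f := by
  simpa using poleZero_mul (γ := γ) hα hβ ht f

lemma poleOne_X_sub_C_mul (hα : 0 < α) (hβ : 0 < β) (ht : t < 0) (f : ℝ[X]) :
    poleOne α β γ t ((X - C t) * f) =
      (1 - t) * poleOne α β γ t f - β * weightFun α β γ t f := by
  rw [sub_mul, map_sub, map_C_mul, poleOne_X_mul hα hβ ht]
  ring

lemma derivative_mem_degreeLT {f : ℝ[X]} {n : ℕ} (hf : f ∈ degreeLT ℝ (n + 1)) :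
    derivative f ∈ degreeLT ℝ n := by
  rw [degreeLT_coeff] at *
  intro m hm
  rw [coeff_derivative, hf (m + 1) (by omega), zero_mul]

lemma X_mul_derivative_mem_degreeLT {f : ℝ[X]} {n : ℕ} (hf : f ∈ degreeLT ℝ n) :
    X * derivative f ∈ degreeLT ℝ n := by
  rw [degreeLT_coeff] at *
  intro m hm
  rcases m with _ | m
  · simp
  · rw [coeff_X_mul, coeff_derivative, hf (m + 1) hm, zero_mul]

lemma coeff_X_mul_derivative (f : ℝ[X]) (m : ℕ) : (X * derivative f).coeff m = m * f.coeff m := by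
  rcases m with _ | m
  · simp
  · rw [coeff_X_mul, coeff_derivative]
    push_cast
    ring

/-- Integration by parts of `P n ^ 2`. -/
lemma poleZero_P_mul_self (hα : 0 < α) (hβ : 0 < β) (ht : t < 0) (n : ℕ) :
    poleZero α β γ t (P α β γ n t * P α β γ n t) =
      poleOne α β γ t (P α β γ n t * P α β γ n t) - poleT α β γ t (P α β γ n t * P α β γ n t) := by
  have H := isOrthogonalFor (γ := γ) hα hβ ht
  have h1 := weightFun_derivative (γ := γ) hα hβ ht (P α β γ n t * P α β γ n t)
  have h2 := H.mul_eq_zero (derivative_mem_degreeLT (H.mem_degreeLT (Nat.lt_succ_self n)))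
  rw [derivative_mul, map_add, mul_comm (derivative _), h2] at h1
  linarith

/-- Integration by parts of `x P n ^ 2`. -/
lemma mul_poleTDiag (hα : 0 < α) (hβ : 0 < β) (ht : t < 0) (n : ℕ) :
    t * poleTDiag α β γ n t = R α β γ n t - (2 * n + α + β + γ + 1) := by
  have H := isOrthogonalFor (γ := γ) hα hβ ht
  have h1 := weightFun_derivative (γ := γ) hα hβ ht (X * (P α β γ n t * P α β γ n t))
  have h2 := H.mul_eq_coeff (X_mul_derivative_mem_degreeLT (H.mem_degreeLT (Nat.lt_succ_self n)))
  rw [coeff_X_mul_derivative, H.coeff_self] at h2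
  have e : derivative (X * (P α β γ n t * P α β γ n t)) = P α β γ n t * P α β γ n t +
      P α β γ n t * (X * derivative (P α β γ n t)) +
      P α β γ n t * (X * derivative (P α β γ n t)) := by
    simp only [derivative_mul, derivative_X]
    ring
  rw [e, map_add, map_add, h2, H.mul_self, poleZero_X_mul hα hβ ht, poleT_X_mul hα hβ ht,
    poleOne_X_mul hα hβ ht, H.mul_self] at h1
  have := H.ne_zero n
  rw [R_eq hα hβ ht, poleTDiag]
  field_simp
  linear_combination h1

/-- Integration by parts of `P (n + 1) P n`. -/
lemma poleZero_P_succ_mul (hα : 0 < α) (hβ : 0 < β) (ht : t < 0) (n : ℕ) :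
    poleZero α β γ t (P α β γ (n + 1) t * P α β γ n t) = h α β γ n t *
      (poleOneOff α β γ (n + 1) t - poleTOff α β γ (n + 1) t - (n + 1)) := by
  have H := isOrthogonalFor (γ := γ) hα hβ ht
  have h1 := weightFun_derivative (γ := γ) hα hβ ht (P α β γ (n + 1) t * P α β γ n t)
  have h2 := H.mul_eq_coeff (n := n)
    (derivative_mem_degreeLT (H.mem_degreeLT (Nat.lt_succ_self (n + 1))))
  have h3 := H.mul_eq_zero (n := n + 1) (f := derivative (P α β γ n t)) (derivative_mem_degreeLT
    (H.mem_degreeLT (by omega)))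
  rw [coeff_derivative, H.coeff_self] at h2
  rw [derivative_mul, map_add, mul_comm (derivative _), h2, h3] at h1
  have := H.ne_zero n
  rw [poleOneOff, poleTOff]
  field_simp
  linear_combination h1

/-- Integration by parts of `x P (n + 1) P n`. -/
lemma mul_poleTOff (hα : 0 < α) (hβ : 0 < β) (ht : t < 0) (n : ℕ) :
    t * poleTOff α β γ (n + 1) t =
      poleOneOff α β γ (n + 1) t + (P α β γ (n + 1) t).coeff n := by
  have H := isOrthogonalFor (γ := γ) hα hβ ht
  have h1 := weightFun_derivative (γ := γ) hα hβ ht (X * (P α β γ (n + 1) t * P α β γ n t))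
  have hmem : X * derivative (P α β γ (n + 1) t) - C ((n : ℝ) + 1) * P α β γ (n + 1) t ∈
      degreeLT ℝ (n + 1) := by
    have := H.sub_mem_degreeLT
      (X_mul_derivative_mem_degreeLT (H.mem_degreeLT (Nat.lt_succ_self (n + 1))))
    rw [coeff_X_mul_derivative, H.coeff_self] at this
    simpa using this
  have h2 := H.mul_eq_coeff hmem
  rw [coeff_sub, coeff_X_mul_derivative, coeff_C_mul] at h2
  have h3 := H.mul_eq_zero (n := n + 1)
    (X_mul_derivative_mem_degreeLT (H.mem_degreeLT (Nat.lt_succ_self n)))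
  have h4 := H.mul_eq_zero (H.mem_degreeLT (Nat.lt_succ_self n))
  have e : derivative (X * (P α β γ (n + 1) t * P α β γ n t)) =
      C ((n : ℝ) + 1 + 1) * (P α β γ (n + 1) t * P α β γ n t) +
      P α β γ n t *
        (X * derivative (P α β γ (n + 1) t) - C ((n : ℝ) + 1) * P α β γ (n + 1) t) +
      P α β γ (n + 1) t * (X * derivative (P α β γ n t)) := by
    simp only [derivative_mul, derivative_X, C_add, C_1]
    ring
  rw [e, map_add, map_add, map_C_mul, h2, h3, poleZero_X_mul hα hβ ht, poleT_X_mul hα hβ ht,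
    poleOne_X_mul hα hβ ht, h4] at h1
  have := H.ne_zero n
  rw [poleOneOff, poleTOff]
  field_simp
  linear_combination h1

lemma R_ne_zero (hα : 0 < α) (hβ : 0 < β) (ht : t < 0) (n : ℕ) : R α β γ n t ≠ 0 := by
  rw [R_eq hα hβ ht]
  exact (div_pos (poleOne_mul_self_pos hα hβ ht (P_ne_zero n t)) (h_pos hα hβ ht n)).ne'

lemma poleTDiag_ne_zero (hα : 0 < α) (hβ : 0 < β) (hγ : γ ≠ 0) (ht : t < 0) (n : ℕ) :
    poleTDiag α β γ n t ≠ 0 :=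
  div_ne_zero (poleT_mul_self_ne_zero hα hβ hγ ht (P_ne_zero n t)) (h_pos hα hβ ht n).ne'

lemma R_sub_poleTDiag (hα : 0 < α) (hβ : 0 < β) (ht : t < 0) (n : ℕ) :
    R α β γ n t - poleTDiag α β γ n t =
      poleZero α β γ t (P α β γ n t * P α β γ n t) / h α β γ n t := by
  rw [R_eq hα hβ ht, poleTDiag, poleZero_P_mul_self hα hβ ht, sub_div]

lemma R_sub_poleTDiag_ne_zero (hα : 0 < α) (hβ : 0 < β) (ht : t < 0) (n : ℕ) :
    R α β γ n t - poleTDiag α β γ n t ≠ 0 := by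
  rw [R_sub_poleTDiag hα hβ ht]
  exact (div_pos (poleZero_mul_self_pos hα hβ ht (P_ne_zero n t)) (h_pos hα hβ ht n)).ne'

lemma poleOneOff_quadratic (hα : 0 < α) (hβ : 0 < β) (ht : t < 0) (n : ℕ) :
    poleOneOff α β γ (n + 1) t * (poleOneOff α β γ (n + 1) t + β) =
      h α β γ (n + 1) t / h α β γ n t * (R α β γ (n + 1) t * R α β γ n t) := by
  have H := isOrthogonalFor (γ := γ) hα hβ ht
  have := H.pole_quadratic (poleOne_mul hα hβ ht) n
  have h0 := H.ne_zero n
  have h1 := H.ne_zero (n + 1)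
  rw [poleOneOff, R_eq hα hβ ht, R_eq hα hβ ht]
  field_simp
  linear_combination this

lemma poleTOff_quadratic (hα : 0 < α) (hβ : 0 < β) (ht : t < 0) (n : ℕ) :
    poleTOff α β γ (n + 1) t * (poleTOff α β γ (n + 1) t - γ) =
      h α β γ (n + 1) t / h α β γ n t * (poleTDiag α β γ (n + 1) t * poleTDiag α β γ n t) := by
  have H := isOrthogonalFor (γ := γ) hα hβ ht
  have := H.pole_quadratic (poleT_mul hα hβ ht) n
  have h0 := H.ne_zero n
  have h1 := H.ne_zero (n + 1)
  rw [poleTOff, poleTDiag, poleTDiag]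
  field_simp
  linear_combination this

/-- The constraint obtained by eliminating the quantities of index `n - 1` from the quadratic
relations at the three poles `0`, `t` and `1`. -/
lemma pole_constraint (hα : 0 < α) (hβ : 0 < β) (ht : t < 0) (n : ℕ) :
    R α β γ n t * poleTDiag α β γ n t *
      (poleOneOff α β γ n t * (poleOneOff α β γ n t + β)
        + poleTOff α β γ n t * (poleTOff α β γ n t - γ)
        - (poleOneOff α β γ n t - poleTOff α β γ n t - n) *
          (poleOneOff α β γ n t - poleTOff α β γ n t - n - α)) =
      R α β γ n t ^ 2 * (poleTOff α β γ n t * (poleTOff α β γ n t - γ))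
        + poleTDiag α β γ n t ^ 2 * (poleOneOff α β γ n t * (poleOneOff α β γ n t + β)) := by
  cases n with
  | zero => simp [poleOneOff, poleTOff]
  | succ n =>
    have H := isOrthogonalFor (γ := γ) hα hβ ht
    have h0 := H.ne_zero n
    have h1 := H.ne_zero (n + 1)
    have key : (poleOneOff α β γ (n + 1) t - poleTOff α β γ (n + 1) t - (n + 1)) *
        (poleOneOff α β γ (n + 1) t - poleTOff α β γ (n + 1) t - (n + 1) - α) =
        h α β γ (n + 1) t / h α β γ n t * ((R α β γ (n + 1) t - poleTDiag α β γ (n + 1) t) *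
          (R α β γ n t - poleTDiag α β γ n t)) := by
      have := H.pole_quadratic (poleZero_mul hα hβ ht) n
      rw [poleZero_P_succ_mul hα hβ ht] at this
      rw [R_sub_poleTDiag hα hβ ht, R_sub_poleTDiag hα hβ ht]
      field_simp
      linear_combination this
    push_cast
    rw [key, poleOneOff_quadratic hα hβ ht, poleTOff_quadratic hα hβ ht]
    ring

/-! ### The differential system -/

lemma hasDerivAt_h (hα : 0 < α) (hβ : 0 < β) (ht : t < 0) (n : ℕ) :
    HasDerivAt (h α β γ n) (-(poleTDiag α β γ n t * h α β γ n t)) t := by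
  have H := isOrthogonalFor (γ := γ) hα hβ ht
  obtain ⟨q, hq, hd, -⟩ := exists_deriv_P (γ := γ) hα hβ ht n
  refine (hasDerivAt_form hα hβ ht (natDegree_P_mul_P_lt n n) hd hd).congr_deriv ?_
  rw [map_add, mul_comm q, H.mul_eq_zero hq, poleTDiag, div_mul_cancel₀ _ (H.ne_zero n)]
  ring

lemma recBeta_eq (hα : 0 < α) (hβ : 0 < β) (ht : t < 0) (n : ℕ) :
    recBeta α β γ (n + 1) t = h α β γ (n + 1) t / h α β γ n t := by
  rw [recBeta, form_eq hα hβ ht, (isOrthogonalFor hα hβ ht).beta_eq]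

lemma hasDerivAt_recBeta (hα : 0 < α) (hβ : 0 < β) (ht : t < 0) (n : ℕ) :
    HasDerivAt (recBeta α β γ (n + 1))
      ((poleTDiag α β γ n t - poleTDiag α β γ (n + 1) t) * recBeta α β γ (n + 1) t) t := by
  have h0 := (h_pos (γ := γ) hα hβ ht n).ne'
  refine (((hasDerivAt_h (γ := γ) hα hβ ht (n + 1)).div (hasDerivAt_h hα hβ ht n)
    h0).congr_of_eventuallyEq ?_).congr_deriv ?_
  · filter_upwards [Iio_mem_nhds ht] with s hs
    exact recBeta_eq hα hβ hs n
  · rw [recBeta_eq hα hβ ht]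
    field_simp
    ring

/-- In the derivative of `∫ P n ^ 2 w / (1 - x)`, the term with `q = dP n/dt` is reduced to
`poleOneOff` and `poleTOff` through the formula for `(X - t) q`. The hypothesis
`γ ≠ 0` serves to see that `P (n - 1)` does not vanish at `t`, which that formula relies on. -/
lemma hasDerivAt_R (hα : 0 < α) (hβ : 0 < β) (hγ : γ ≠ 0) (ht : t < 0) (n : ℕ) :
    HasDerivAt (R α β γ n) (((1 - t) * poleTDiag α β γ n t * R α β γ n t
      + 2 * (R α β γ n t * poleTOff α β γ n t - poleTDiag α β γ n t * poleOneOff α β γ n t)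
      - β * poleTDiag α β γ n t - γ * R α β γ n t) / (1 - t)) t := by
  have H := isOrthogonalFor (γ := γ) hα hβ ht
  have h1t : 1 - t ≠ 0 := by linarith
  have h0 := H.ne_zero n
  obtain ⟨q, hq, hd, hqL⟩ := exists_deriv_P (γ := γ) hα hβ ht n
  have key : (1 - t) * poleOne α β γ t (P α β γ n t * q) = h α β γ n t *
      (R α β γ n t * poleTOff α β γ n t - poleTDiag α β γ n t * poleOneOff α β γ n t) := by
    cases n with
    | zero =>
      have : q = 0 := by
        ext k
        simpa using degreeLT_coeff.1 hq k (Nat.zero_le k)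
      simp [this, poleTOff, poleOneOff]
    | succ n =>
      have h0' := H.ne_zero n
      have h2 := poleOne_X_sub_C_mul (γ := γ) hα hβ ht (P α β γ (n + 1) t * q)
      rw [H.mul_eq_zero hq, mul_left_comm, H.X_sub_C_mul_deriv_succ (poleT_mul hα hβ ht)
        (poleT_mul_self_ne_zero hα hβ hγ ht (P_ne_zero n t)) hq hqL, mul_sub, map_sub,
        mul_left_comm, map_C_mul, mul_left_comm, map_C_mul] at h2
      rw [poleTOff, poleTDiag, poleOneOff, R_eq hα hβ ht]
      field_simp
      field_simp at h2
      linear_combination -h2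
  have hnum := hasDerivAt_poleOne (γ := γ) hα hβ ht (natDegree_P_mul_P_lt n n) (hd.mul hd)
  refine ((hnum.div (hasDerivAt_h hα hβ ht n) h0).congr_of_eventuallyEq ?_).congr_deriv ?_
  · filter_upwards [Iio_mem_nhds ht] with s hs
    exact R_eq hα hβ hs n
  · have e1 : poleOne α β γ t (P α β γ n t * P α β γ n t) = R α β γ n t * h α β γ n t := by
      rw [R_eq hα hβ ht, div_mul_cancel₀ _ h0]
    have e2 : poleT α β γ t (P α β γ n t * P α β γ n t) = poleTDiag α β γ n t * h α β γ n t := by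
      rw [poleTDiag, div_mul_cancel₀ _ h0]
    rw [map_add, mul_comm q, e1, e2]
    field_simp
    linear_combination 2 * key

/-- The derivative first appears as `h n / h (n - 1)` times a combination of quantities of indices `n`
and `n - 1`; the quadratic relations at `1` and `t` remove the index `n - 1`. -/
lemma hasDerivAt_poleOneOff (hα : 0 < α) (hβ : 0 < β) (hγ : γ ≠ 0) (ht : t < 0) (n : ℕ) :
    HasDerivAt (poleOneOff α β γ n)
      ((R α β γ n t ^ 2 * (poleTOff α β γ n t * (poleTOff α β γ n t - γ))
        - poleTDiag α β γ n t ^ 2 * (poleOneOff α β γ n t * (poleOneOff α β γ n t + β))) /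
        (R α β γ n t * poleTDiag α β γ n t * (1 - t))) t := by
  cases n with
  | zero => exact (hasDerivAt_const t (0 : ℝ)).congr_deriv (by simp [poleOneOff, poleTOff])
  | succ n =>
  have H := isOrthogonalFor (γ := γ) hα hβ ht
  have h1t : 1 - t ≠ 0 := by linarith
  have h0 := H.ne_zero n
  have h1 := H.ne_zero (n + 1)
  obtain ⟨q, hq, hd, hqL⟩ := exists_deriv_P (γ := γ) hα hβ ht (n + 1)
  obtain ⟨q₀, hq₀, hd₀, hqL₀⟩ := exists_deriv_P (γ := γ) hα hβ ht n
  have hne := poleT_mul_self_ne_zero hα hβ hγ ht (P_ne_zero (α := α) (β := β) (γ := γ) n t)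
  have k1 := poleOne_X_sub_C_mul (γ := γ) hα hβ ht (q * P α β γ n t)
  have k2 := poleOne_X_sub_C_mul (γ := γ) hα hβ ht (P α β γ (n + 1) t * q₀)
  have k3 := poleOne_X_sub_C_mul (γ := γ) hα hβ ht (P α β γ (n + 1) t * P α β γ n t)
  rw [H.mul_eq_zero (H.mem_degreeLT (Nat.lt_succ_self n))] at k3
  rw [hqL _ (H.mem_degreeLT (Nat.lt_succ_self n)), ← mul_assoc,
    H.X_sub_C_mul_deriv_succ (poleT_mul hα hβ ht) hne hq hqL, sub_mul, mul_assoc, mul_assoc,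
    map_sub, map_C_mul, map_C_mul] at k1
  have e : P α β γ (n + 1) t * (C (γ - poleT α β γ t (P α β γ (n + 1) t * P α β γ n t) /
      h α β γ n t) * P α β γ n t - C (poleT α β γ t (P α β γ n t * P α β γ n t) / h α β γ n t) *
      ((X - C t) * P α β γ n t - P α β γ (n + 1) t)) =
      C (γ - poleT α β γ t (P α β γ (n + 1) t * P α β γ n t) / h α β γ n t) *
        (P α β γ (n + 1) t * P α β γ n t) -
      C (poleT α β γ t (P α β γ n t * P α β γ n t) / h α β γ n t) *
      ((X - C t) * (P α β γ (n + 1) t * P α β γ n t) - P α β γ (n + 1) t * P α β γ (n + 1) t) := by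
    ring
  rw [H.mul_eq_zero (n := n + 1) (f := q₀)
    (degreeLT_coeff.2 fun m hm => degreeLT_coeff.1 hq₀ m (by omega)), mul_left_comm,
    H.X_sub_C_mul_deriv (poleT_mul hα hβ ht) hne hq₀ hqL₀, e, map_sub, map_C_mul, map_C_mul,
    map_sub, k3] at k2
  have hnum := hasDerivAt_poleOne (γ := γ) hα hβ ht (natDegree_P_mul_P_lt (n + 1) n) (hd.mul hd₀)
  refine (hnum.div (hasDerivAt_h hα hβ ht n) h0).congr_deriv ?_
  have e1 : ∀ m, poleOne α β γ t (P α β γ m t * P α β γ m t) = R α β γ m t * h α β γ m t :=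
    fun m => by rw [R_eq hα hβ ht, div_mul_cancel₀ _ (H.ne_zero m)]
  have e2 : ∀ m, poleT α β γ t (P α β γ m t * P α β γ m t) =
      poleTDiag α β γ m t * h α β γ m t :=
    fun m => by rw [poleTDiag, div_mul_cancel₀ _ (H.ne_zero m)]
  have e3 : poleOne α β γ t (P α β γ (n + 1) t * P α β γ n t) =
      poleOneOff α β γ (n + 1) t * h α β γ n t := by rw [poleOneOff, div_mul_cancel₀ _ h0]
  have e4 : poleT α β γ t (P α β γ (n + 1) t * P α β γ n t) =
      poleTOff α β γ (n + 1) t * h α β γ n t := by rw [poleTOff, div_mul_cancel₀ _ h0]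
  have hR := R_ne_zero (γ := γ) hα hβ ht (n + 1)
  have hG := poleTDiag_ne_zero hα hβ hγ ht (n + 1)
  rw [poleOneOff_quadratic hα hβ ht, poleTOff_quadratic hα hβ ht]
  simp only [e1, e2, e3, e4] at k1 k2 ⊢
  rw [map_add]
  field_simp
  field_simp at k1 k2
  linear_combination -k1 - k2

/-- The relation `t * poleTOff = poleOneOff + p`, with `p` the subleading coefficient of `P n` and
`p' = poleTOff`, makes `t * poleTOff'` equal to `poleOneOff'`. -/
lemma hasDerivAt_poleTOff (hα : 0 < α) (hβ : 0 < β) (hγ : γ ≠ 0) (ht : t < 0) (n : ℕ) :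
    HasDerivAt (poleTOff α β γ n)
      ((R α β γ n t ^ 2 * (poleTOff α β γ n t * (poleTOff α β γ n t - γ))
        - poleTDiag α β γ n t ^ 2 * (poleOneOff α β γ n t * (poleOneOff α β γ n t + β))) /
        (R α β γ n t * poleTDiag α β γ n t * (1 - t)) / t) t := by
  cases n with
  | zero => exact (hasDerivAt_const t (0 : ℝ)).congr_deriv (by simp [poleOneOff, poleTOff])
  | succ n =>
  have H := isOrthogonalFor (γ := γ) hα hβ ht
  have h0 := H.ne_zero n
  obtain ⟨q, hq, hd, hqL⟩ := exists_deriv_P (γ := γ) hα hβ ht (n + 1)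
  -- the subleading coefficient of `P (n + 1)` has derivative `poleTOff (n + 1)`
  have hcoeff : q.coeff n = poleTOff α β γ (n + 1) t := by
    rw [poleTOff, eq_div_iff h0, ← H.mul_eq_coeff hq, mul_comm,
      hqL _ (H.mem_degreeLT (Nat.lt_succ_self n))]
  have h1 := hd n
  rw [hcoeff] at h1
  refine ((((hasDerivAt_poleOneOff hα hβ hγ ht (n + 1)).add h1).div (hasDerivAt_id t)
    ht.ne).congr_of_eventuallyEq ?_).congr_deriv ?_
  · filter_upwards [Iio_mem_nhds ht] with s hs
    have hs : s < 0 := hs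
    simp only [Pi.div_apply, Pi.add_apply, id_eq]
    rw [eq_div_iff hs.ne, ← mul_poleTOff hα hβ hs, mul_comm]
  · have h2 := mul_poleTOff (γ := γ) hα hβ ht n
    have ht0 := ht.ne
    simp only [id_eq, Pi.add_apply]
    rw [← h2]
    field_simp
    ring

end

/-! ### From the differential system to the sixth Painlevé equation -/

/-- The values of the first and second derivative of `W = t A / c` prescribed by the differential
system satisfy the Painlevé VI equation; the error
is a multiple of the algebraic constraint `hF`. -/
lemma painleveVI_identity {t T R G A r g n α β γ c U R' G' r' D' : ℝ} (ht : t ≠ 0) (hT0 : T ≠ 0)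
    (hR : R ≠ 0) (hG : G ≠ 0) (hA0 : A ≠ 0) (hc0 : c ≠ 0)
    (hT : T = t - 1) (hA : A = R - G) (hc : c = R - t * G) (hα : α = c - 1 - 2 * n - β - γ)
    (hU : U = -T * G * R + 2 * (R * g - G * r) - β * G - γ * R)
    (hR' : R' = -(U / T)) (hG' : G' = (R' - G) / t)
    (hr' : r' = (R ^ 2 * (g * (g - γ)) - G ^ 2 * (r * (r + β))) / (R * G * -T))
    (hD' : D' = R' * g + R * (r' / t) - (G' * r + G * r'))
    (hF : R * G * (r * (r + β) + g * (g - γ) - (r - g - n) * (r - g - n - α)) =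
      R ^ 2 * (g * (g - γ)) + G ^ 2 * (r * (r + β))) :
    (R' - (-(G * R) + -T * (G' * R + G * R') + 2 * D' - β * G' - γ * R')) / c =
      1 / 2 * (1 / (t * A / c) + 1 / (T * R / c) + 1 / (t * T * G / c)) *
        ((R - U) / c) ^ 2
      - (1 / t + 1 / T + 1 / (t * T * G / c)) * ((R - U) / c)
      + (t * A / c) * (T * R / c) * (t * T * G / c) / (t ^ 2 * T ^ 2) *
        (c ^ 2 / 2 + -(α ^ 2 / 2) * t / (t * A / c) ^ 2
          + β ^ 2 / 2 * T / (T * R / c) ^ 2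
          + (1 - γ ^ 2) / 2 * t * T / (t * T * G / c) ^ 2) := by
  subst hD' hr' hG' hR'
  field_simp
  subst hA hα hc hU hT
  linear_combination (4 * R * G * (t - 1)) * hF

/-- If `R`, `G = (R - c) / t`, `r` and `g` obey the differential system and the algebraic
constraint, then `W = (t - 1) R / c + 1` solves Painlevé VI. The three factors of the equation are
`W = t (R - G) / c`, `W - 1 = (t - 1) R / c` and `W - t = t (t - 1) G / c`. -/
lemma solvesPainleveVI_of_system {n α β γ : ℝ} {R G r g : ℝ → ℝ}
    (hc0 : 2 * n + α + β + γ + 1 ≠ 0)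
    (hc : ∀ t < 0, t * G t = R t - (2 * n + α + β + γ + 1))
    (hR0 : ∀ t < 0, R t ≠ 0) (hG0 : ∀ t < 0, G t ≠ 0) (hA0 : ∀ t < 0, R t - G t ≠ 0)
    (hR : ∀ t < 0, HasDerivAt R (((1 - t) * G t * R t + 2 * (R t * g t - G t * r t) - β * G t
      - γ * R t) / (1 - t)) t)
    (hr : ∀ t < 0, HasDerivAt r ((R t ^ 2 * (g t * (g t - γ)) - G t ^ 2 * (r t * (r t + β))) /
      (R t * G t * (1 - t))) t)
    (hg : ∀ t < 0, HasDerivAt g ((R t ^ 2 * (g t * (g t - γ)) - G t ^ 2 * (r t * (r t + β))) /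
      (R t * G t * (1 - t)) / t) t)
    (hF : ∀ t < 0, R t * G t * (r t * (r t + β) + g t * (g t - γ)
      - (r t - g t - n) * (r t - g t - n - α)) =
      R t ^ 2 * (g t * (g t - γ)) + G t ^ 2 * (r t * (r t + β))) :
    SolvesPainleveVI ((2 * n + α + β + γ + 1) ^ 2 / 2) (-(α ^ 2 / 2)) (β ^ 2 / 2)
      ((1 - γ ^ 2) / 2) (Iio 0) (fun t => (t - 1) * R t / (2 * n + α + β + γ + 1) + 1) := by
  obtain ⟨c, hcdef⟩ : ∃ c, c = 2 * n + α + β + γ + 1 := ⟨_, rfl⟩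
  rw [← hcdef] at hc0 hc ⊢
  set W : ℝ → ℝ := fun t => (t - 1) * R t / c + 1 with hWdef
  set U : ℝ → ℝ := fun t => (1 - t) * G t * R t + 2 * (R t * g t - G t * r t) - β * G t
    - γ * R t with hUdef
  have hW' : ∀ t < 0, HasDerivAt W ((R t - U t) / c) t := by
    intro t ht
    have h1 : 1 - t ≠ 0 := by linarith
    refine (((((hasDerivAt_id t).sub_const 1).mul (hR t ht)).div_const c).add_const 1).congr_deriv ?_
    simp only [hUdef, id_eq]
    field_simp
    ring
  intro t ht
  have ht : t < 0 := ht
  have ht0 : t ≠ 0 := ht.ne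
  have hT : t - 1 ≠ 0 := by linarith
  have h1t : 1 - t ≠ 0 := by linarith
  have hA := hA0 t ht
  have hGc := hc t ht
  have eW : W t = t * (R t - G t) / c := by
    simp only [hWdef]; field_simp; linear_combination hGc
  have eW1 : W t - 1 = (t - 1) * R t / c := by simp only [hWdef]; ring
  have eWt : W t - t = t * (t - 1) * G t / c := by
    simp only [hWdef]; field_simp; linear_combination (1 - t) * hGc
  have hderiv : deriv W =ᶠ[𝓝 t] fun s => (R s - U s) / c := by
    filter_upwards [Iio_mem_nhds ht] with s hs using (hW' s hs).deriv
  have hG : HasDerivAt G ((U t / (1 - t) - G t) / t) t := by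
    have h1 := ((hR t ht).sub_const c).div (hasDerivAt_id t) ht0
    refine (h1.congr_of_eventuallyEq ?_).congr_deriv ?_
    · filter_upwards [Iio_mem_nhds ht] with s hs
      have hs0 : s ≠ 0 := (show s < 0 from hs).ne
      simp only [Pi.div_apply, id_eq]
      rw [eq_div_iff hs0, ← hc s hs, mul_comm]
    · simp only [id_eq, hUdef]
      field_simp
      linear_combination (1 - t) * hGc
  have hU : HasDerivAt U _ t :=
    ((((((hasDerivAt_id t).const_sub 1).mul hG).mul (hR t ht)).add
      ((((hR t ht).mul (hg t ht)).sub (hG.mul (hr t ht))).const_mul 2)).sub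
      (hG.const_mul β)).sub ((hR t ht).const_mul γ)
  have hW'' := (((hR t ht).sub hU).div_const c).congr_of_eventuallyEq hderiv
  refine ⟨ht0, fun h => hT (by rw [h]; ring), ?_, ?_, ?_, (hW' t ht).differentiableAt,
    hW''.differentiableAt, ?_⟩
  · rw [eW]; exact div_ne_zero (mul_ne_zero ht0 hA) hc0
  · rw [← sub_ne_zero, eW1]; exact div_ne_zero (mul_ne_zero hT (hR0 t ht)) hc0
  · rw [← sub_ne_zero, eWt]
    exact div_ne_zero (mul_ne_zero (mul_ne_zero ht0 hT) (hG0 t ht)) hc0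
  · rw [hW''.deriv, (hW' t ht).deriv, eW1, eWt, eW]
    rw [← painleveVI_identity (t := t) (T := t - 1) (R := R t) (G := G t) (r := r t) (g := g t)
      (n := n) ht0 hT (hR0 t ht) (hG0 t ht) hA hc0 rfl rfl (by linear_combination hGc)
      (by rw [hcdef]; ring) (by simp only [hUdef]; ring) rfl rfl rfl rfl (hF t ht)]
    congr 1
    have e : -(t - 1) = 1 - t := by ring
    have e2 : -(U t / (t - 1)) = U t / (1 - t) := by rw [← e, div_neg]
    rw [e, e2]
    simp only [hUdef, id_eq, Pi.mul_apply]
    ring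

end GenJacobi

end

theorem theorem2 (α β γ : ℝ) (hα : 0 < α) (hβ : 0 < β) :
    (∀ t : ℝ, t < 0 →
      GenJacobi.IsMonicOPSystem (GenJacobi.weight α β γ t)
        (fun n => GenJacobi.P α β γ n t) (fun n => GenJacobi.h α β γ n t) ∧
      GenJacobi.ThreeTermRecurrence (fun n => GenJacobi.P α β γ n t)
        (fun n => GenJacobi.recAlpha α β γ n t) (fun n => GenJacobi.recBeta α β γ n t) ∧
      ∀ n : ℕ, IntervalIntegrable (GenJacobi.integrandR α β γ n t) MeasureTheory.volume 0 1) ∧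
    (∀ n : ℕ, 1 ≤ n → ∀ t : ℝ, t < 0 →
      DifferentiableAt ℝ (GenJacobi.recBeta α β γ n) t ∧
      t * deriv (GenJacobi.recBeta α β γ n) t =
        (2 + GenJacobi.R α β γ (n - 1) t - GenJacobi.R α β γ n t) *
          GenJacobi.recBeta α β γ n t) ∧
    (∀ n : ℕ, 2 * (n : ℝ) + α + β + γ + 1 ≠ 0 →
      (γ ≠ 0 →
        GenJacobi.SolvesPainleveVI
          ((2 * (n : ℝ) + α + β + γ + 1) ^ 2 / 2) (-(α ^ 2 / 2)) (β ^ 2 / 2) ((1 - γ ^ 2) / 2)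
          (Set.Iio 0) (GenJacobi.W α β γ n)) ∧
      (γ = 0 → ∀ t : ℝ, t < 0 → GenJacobi.W α β γ n t = t)) := by
  refine ⟨fun t ht => ?_, fun n hn t ht => ?_, fun n hc => ⟨fun hγ => ?_, fun hγ t ht => ?_⟩⟩
  · have H := GenJacobi.isOrthogonalFor (γ := γ) hα hβ ht
    refine ⟨⟨H.monic, H.natDegree_eq, fun m n => ?_, fun m n => ?_,
      GenJacobi.h_pos hα hβ ht⟩, ⟨H.three_term.init, ?_, fun n => ?_⟩, fun n => ?_⟩
    · simpa using GenJacobi.intervalIntegrable_eval_mul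
        (GenJacobi.intervalIntegrable_weight (γ := γ) hα hβ ht)
        (GenJacobi.P α β γ m t * GenJacobi.P α β γ n t)
    · rw [← H.orthogonal, ← GenJacobi.form_eq hα hβ ht, GenJacobi.form]
    · simpa only [GenJacobi.recAlpha, GenJacobi.form_eq hα hβ ht] using H.three_term.zero
    · simpa only [GenJacobi.recAlpha, GenJacobi.recBeta, GenJacobi.form_eq hα hβ ht,
        Nat.add_sub_cancel] using H.three_term.succ n
    · refine (GenJacobi.intervalIntegrable_eval_mul
        (GenJacobi.intervalIntegrable_weight_div_one_sub (γ := γ) hα hβ ht)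
        (GenJacobi.P α β γ n t * GenJacobi.P α β γ n t)).congr fun x _ => ?_
      simp only [GenJacobi.integrandR, Polynomial.eval_mul]
      ring
  · obtain ⟨n, rfl⟩ : ∃ k, n = k + 1 := ⟨n - 1, by omega⟩
    have hd := GenJacobi.hasDerivAt_recBeta (γ := γ) hα hβ ht n
    have h0 := GenJacobi.mul_poleTDiag (γ := γ) hα hβ ht n
    have h1 := GenJacobi.mul_poleTDiag (γ := γ) hα hβ ht (n + 1)
    push_cast at h1
    refine ⟨hd.differentiableAt, ?_⟩
    rw [hd.deriv, Nat.add_sub_cancel]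
    linear_combination GenJacobi.recBeta α β γ (n + 1) t * (h0 - h1)
  · exact GenJacobi.solvesPainleveVI_of_system hc
      (fun t ht => GenJacobi.mul_poleTDiag hα hβ ht n)
      (fun t ht => GenJacobi.R_ne_zero hα hβ ht n)
      (fun t ht => GenJacobi.poleTDiag_ne_zero hα hβ hγ ht n)
      (fun t ht => GenJacobi.R_sub_poleTDiag_ne_zero hα hβ ht n)
      (fun t ht => GenJacobi.hasDerivAt_R hα hβ hγ ht n)
      (fun t ht => GenJacobi.hasDerivAt_poleOneOff hα hβ hγ ht n)
      (fun t ht => GenJacobi.hasDerivAt_poleTOff hα hβ hγ ht n)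
      (fun t ht => GenJacobi.pole_constraint hα hβ ht n)
  · -- for `γ = 0` the functional with its pole at `t` is zero, so `R = c`
    have h0 := GenJacobi.mul_poleTDiag (γ := γ) hα hβ ht n
    have hG : GenJacobi.poleTDiag α β γ n t = 0 := by
      simp [GenJacobi.poleTDiag, GenJacobi.poleT, hγ]
    rw [hG, mul_zero] at h0
    rw [GenJacobi.W, show GenJacobi.R α β γ n t = 2 * n + α + β + γ + 1 by linarith]
    field_simp
    ring
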